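/- Theorem 1. Let $F$ be a distribution function on $[0,\infty)$ with a convex density $f$ on $[0,\infty)$, i.e. $F(r)=\int_0^r f(x)\,dx$ for $r\ge 0$, and let $\mathbb{F}(r)=\frac1n\#\{i: X_i\le r\}$ be the empirical distribution function of observations $X_1,\dots,X_n\in[0,\infty)$, $n\ge 1$. Let $\mathcal{K}$ be the set of all real-valued convex and integrable functions on $[0,\infty)$ (these are automatically nonnegative and non-increasing), and write $\int\varphi\,d\mathbb{F}=\frac1n\sum_{i=1}^n\varphi(X_i)$. Let $\hat f_{ml}\in\mathcal{K}$ be a maximum likelihood estimator, that is, a maximizer over $h\in\mathcal{K}$ of $$\int\log h\,d\mathbb{F}-\int_0^\infty h(x)\,dx\qquad(\log 0=-\infty),$$ let $\hat f_{ls}\in\mathcal{K}$ be a least squares estimator, that is, a minimizer over $h\in\mathcal{K}$ of $$\int_0^\infty h(x)^2\,dx-2\int h\,d\mathbb{F},$$ and let $\hat F_{ml}(r)=\int_0^r\hat f_{ml}(x)\,dx$ and $\hat F_{ls}(r)=\int_0^r\hat f_{ls}(x)\,dx$ for $r\ge 0$. Then $$(1)\quad \inf_{[0,\infty)}(\hat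 F_{ml}-F)\;\ge\;\tfrac32\inf_{[0,\infty)}(\mathbb{F}-F)-\tfrac12\sup_{[0,\infty)}(\mathbb{F}-F),$$ $$(2)\quad \|\hat F_{ls}-F\|_\infty\;\le\;2\,\|\mathbb{F}-F\|_\infty,$$ where $\|G\|_\infty=\sup_{x\in[0,\infty)}|G(x)|$. -/

import Mathlib

/-- The convex cone of all real-valued functions on `[0, ∞)` that are convex and Lebesgue
integrable there. Functions are given on `ℝ`, but only their values on `[0, ∞)` matter. -/
def convexIntegrableCone : Set (ℝ → ℝ) :=
  {g | ConvexOn ℝ (Set.Ici 0) g ∧ MeasureTheory.IntegrableOn g (Set.Ici 0)}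

/-- `f` is a convex probability density on `[0, ∞)`. -/
structure IsConvexDensity (f : ℝ → ℝ) : Prop where
  convexOn : ConvexOn ℝ (Set.Ici 0) f
  nonneg : ∀ x, 0 ≤ x → 0 ≤ f x
  integrableOn : MeasureTheory.IntegrableOn f (Set.Ici 0)
  integral_eq_one : ∫ x in Set.Ici (0 : ℝ), f x = 1

/-- The distribution function `r ↦ ∫₀ʳ g(x) dx`, `r ≥ 0`, of a density `g` on `[0, ∞)`. -/
noncomputable def densityCDF (g : ℝ → ℝ) (r : ℝ) : ℝ :=
  ∫ x in (0 : ℝ)..r, g x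

/-- The empirical distribution function of the sample `X 0, …, X (n-1)`: the proportion of
observations that are at most `r`. -/
noncomputable def empiricalCDF {n : ℕ} (X : Fin n → ℝ) (r : ℝ) : ℝ :=
  ((Finset.univ.filter fun i => X i ≤ r).card : ℝ) / n

/-- The integral of `φ` with respect to the empirical distribution of the sample. -/
noncomputable def empiricalIntegral {n : ℕ} (X : Fin n → ℝ) (φ : ℝ → ℝ) : ℝ :=
  (∑ i, φ (X i)) / n

open Classical in
/-- The criterion `∫ log h d𝔽 - ∫₀^∞ h(x) dx` of maximum likelihood estimation, with values in
the extended reals: by the convention `log 0 = -∞` it is `-∞` as soon as `h` fails to be positive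
at some observation. -/
noncomputable def mlCriterion {n : ℕ} (X : Fin n → ℝ) (h : ℝ → ℝ) : EReal :=
  if ∀ i, 0 < h (X i) then
    ((empiricalIntegral X (fun x => Real.log (h x)) - ∫ x in Set.Ici (0 : ℝ), h x : ℝ) : EReal)
  else ⊥

/-- The criterion `∫₀^∞ h(x)² dx - 2 ∫ h d𝔽` of least squares estimation. -/
noncomputable def lsCriterion {n : ℕ} (X : Fin n → ℝ) (h : ℝ → ℝ) : ℝ :=
  (∫ x in Set.Ici (0 : ℝ), h x ^ 2) - 2 * empiricalIntegral X h

/-- `fhat` is a convex-density maximum likelihood estimator for the sample `X`. -/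
def IsConvexMLE {n : ℕ} (X : Fin n → ℝ) (fhat : ℝ → ℝ) : Prop :=
  fhat ∈ convexIntegrableCone ∧ IsMaxOn (mlCriterion X) convexIntegrableCone fhat

/-- `fhat` is a convex-density least squares estimator for the sample `X`. -/
def IsConvexLSE {n : ℕ} (X : Fin n → ℝ) (fhat : ℝ → ℝ) : Prop :=
  fhat ∈ convexIntegrableCone ∧ IsMinOn (lsCriterion X) convexIntegrableCone fhat

open Set MeasureTheory Filter Topology

/-! Both estimators satisfy first order conditions of one type: L(g - f̂) ≥ 0 for all g in the cone,
where L(φ) = ∫ a φ dx - ∫ w φ d𝔽. Least squares has a = f̂, w = 1; maximum likelihood has a = 1, w =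
1/f̂. Let G (`scoreCDF`) be the distribution function of a minus the w-weighted empirical one, and H
(`scorePrimitive`) its primitive. Then H(z) = L((z - x)₊) ≥ 0, and G = 0 wherever H = 0
(`scoreCDF_eq_zero`). Where H > 0, flattening a kink of f̂ would contradict the first order
conditions, so f̂ is affine on each component of {H > 0} (`subgradient_eq`, `exists_slope`).

At zeros of H one has F̂ = 𝔽. For least squares this is G = 0. For maximum likelihood, f̂ minus its
tangent at z, cut off to the right of z, can be both added to and subtracted from f̂; so L vanishes
on it, which reads F̂ - 𝔽 = f̂ G - m H at z, with m the slope of the tangent.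

On a bounded component (s, t) the function D = F̂ - F has the concave derivative f̂ - f and agrees
with 𝔽 - F at s and t. Moreover the integral of F̂ - 𝔽 over [s, x] is nonnegative: it is H(x) for
least squares, and f̂(x) H(x) - 2β∫H with slope β ≤ 0 for maximum likelihood. Hence the mean of D
over [s, x] is at least A = inf(𝔽 - F). If D is minimal at an interior y, then on [s, y] it lies
below a parabola with vertex at y, whose mean is (2D(y) + D(s))/3. With D(s) ≤ B = sup(𝔽 - F) this
gives D(y) ≥ (3A - B)/2.

For least squares the integral of F̂ - 𝔽 over [x, t] is -H(x) ≤ 0, so the reflected upper bound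
holds as well. On an unbounded component f̂ = 0, which forces F̂ = 𝔽 for maximum likelihood and is
impossible for least squares. -/

/-! ### Functions with a concave derivative -/

/-- A function on `[s, y]` whose derivative is concave and vanishes at `y` lies below the parabola
with the same values at `s` and `y` and vertex at `y`. -/
theorem le_parabola_of_concaveOn_deriv {D g : ℝ → ℝ} {s y t : ℝ} (hsy : s < y) (hyt : y < t)
    (hcont : ContinuousOn D (Icc s t)) (hderiv : ∀ x ∈ Ioo s t, HasDerivAt D (g x) x)
    (hg : ConcaveOn ℝ (Ioo s t) g) (hgy : g y = 0) {x : ℝ} (hx : x ∈ Icc s y) :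
    D x ≤ D y + (D s - D y) * ((y - x) / (y - s)) ^ 2 := by
  have hys : y - s ≠ 0 := by linarith
  set c : ℝ := (D s - D y) / (y - s) ^ 2 with hc
  have hcs : c * (y - s) ^ 2 = D s - D y := by rw [hc]; field_simp
  have hpar : ∀ x, (D s - D y) * ((y - x) / (y - s)) ^ 2 = c * (y - x) ^ 2 := by
    intro x; rw [hc]; field_simp
  rw [hpar]
  by_contra! hlt
  -- Subtracting the parabola keeps the derivative concave and zero at y. Since q takes equal values
  -- at s and y, exceeding them at x forces q' > 0 at some c₁ < x and q' < 0 at some c₂ in (x, y);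
  -- concavity excludes this, because q'(c₁) > 0 and q'(y) = 0.
  set q : ℝ → ℝ := fun u => D u - c * (y - u) ^ 2 with hq
  have hqcont : ContinuousOn q (Icc s t) := by
    apply hcont.sub; fun_prop
  have hqderiv : ∀ u ∈ Ioo s t, HasDerivAt q (g u + 2 * c * (y - u)) u := by
    intro u hu
    have h1 : HasDerivAt (fun u : ℝ => c * (y - u) ^ 2) (c * (2 * (y - u) * (-1))) u := by
      have := (((hasDerivAt_id u).const_sub y).pow 2).const_mul c
      simpa using this
    exact ((hderiv u hu).sub h1).congr_deriv (by ring)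
  have hqs : q s = D y := by simp only [hq]; linarith
  have hqy : q y = D y := by simp [hq]
  have hqx : D y < q x := by simp only [hq]; linarith
  have hsx : s < x := lt_of_le_of_ne hx.1 (by rintro rfl; linarith)
  have hxy : x < y := lt_of_le_of_ne hx.2 (by rintro rfl; linarith)
  obtain ⟨c₁, hc₁, h1⟩ := exists_hasDerivAt_eq_slope q (fun u => g u + 2 * c * (y - u)) hsx
    (hqcont.mono (Icc_subset_Icc le_rfl (by linarith)))
    (fun u hu => hqderiv u ⟨hu.1, by linarith [hu.2]⟩)
  obtain ⟨c₂, hc₂, h2⟩ := exists_hasDerivAt_eq_slope q (fun u => g u + 2 * c * (y - u)) hxy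
    (hqcont.mono (Icc_subset_Icc hx.1 hyt.le))
    (fun u hu => hqderiv u ⟨by linarith [hu.1], by linarith [hu.2]⟩)
  have h1' : 0 < g c₁ + 2 * c * (y - c₁) := by
    rw [h1]; apply div_pos <;> linarith
  have h2' : g c₂ + 2 * c * (y - c₂) < 0 := by
    rw [h2]; apply div_neg_of_neg_of_pos <;> linarith
  obtain ⟨hc₁a, hc₁b⟩ := hc₁
  obtain ⟨hc₂a, hc₂b⟩ := hc₂
  have hpos : 0 < y - c₁ := by linarith
  have ha : 0 ≤ (y - c₂) / (y - c₁) := div_nonneg (by linarith) hpos.le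
  have hb : 0 ≤ (c₂ - c₁) / (y - c₁) := div_nonneg (by linarith) hpos.le
  have hab : (y - c₂) / (y - c₁) + (c₂ - c₁) / (y - c₁) = 1 := by field_simp; ring
  have hc₁t : c₁ ∈ Ioo s t := ⟨hc₁a, by linarith⟩
  have hconc := hg.2 hc₁t (⟨hsy, hyt⟩ : y ∈ Ioo s t) ha hb hab
  simp only [smul_eq_mul, hgy, mul_zero, add_zero] at hconc
  have harg : (y - c₂) / (y - c₁) * c₁ + (c₂ - c₁) / (y - c₁) * y = c₂ := by
    field_simp; ring
  rw [harg] at hconc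
  have hmul : (y - c₂) / (y - c₁) * (g c₁ + 2 * c * (y - c₁)) ≤ g c₂ + 2 * c * (y - c₂) := by
    have : (y - c₂) / (y - c₁) * (2 * c * (y - c₁)) = 2 * c * (y - c₂) := by field_simp
    linarith [mul_add ((y - c₂) / (y - c₁)) (g c₁) (2 * c * (y - c₁))]
  have : 0 < (y - c₂) / (y - c₁) * (g c₁ + 2 * c * (y - c₁)) :=
    mul_pos (div_pos (by linarith) hpos) h1'
  linarith

/-- Lower bound for a function with concave derivative in terms of its values at the end points
and its integrals over initial segments. -/
theorem lower_bound_of_concaveOn_deriv {D g : ℝ → ℝ} {s t A B : ℝ}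
    (hcont : ContinuousOn D (Icc s t)) (hderiv : ∀ x ∈ Ioo s t, HasDerivAt D (g x) x)
    (hg : ConcaveOn ℝ (Ioo s t) g) (hAs : A ≤ D s) (hsB : D s ≤ B) (hAt : A ≤ D t)
    (hint : ∀ x ∈ Icc s t, A * (x - s) ≤ ∫ u in s..x, D u) {x : ℝ} (hx : x ∈ Icc s t) :
    3 / 2 * A - 1 / 2 * B ≤ D x := by
  obtain ⟨y, hy, hmin⟩ := isCompact_Icc.exists_isMinOn ⟨x, hx⟩ hcont
  refine le_trans ?_ (hmin hx)
  rcases eq_or_lt_of_le hy.1 with rfl | hsy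
  · linarith
  rcases eq_or_lt_of_le hy.2 with rfl | hyt
  · linarith
  have hgy : g y = 0 :=
    (hmin.isLocalMin (Icc_mem_nhds hsy hyt)).hasDerivAt_eq_zero (hderiv y ⟨hsy, hyt⟩)
  have hys : 0 < y - s := by linarith
  have hle : ∫ u in s..y, D u ≤ ∫ u in s..y, (D y + (D s - D y) * ((y - u) / (y - s)) ^ 2) := by
    apply intervalIntegral.integral_mono_on hsy.le
    · apply ContinuousOn.intervalIntegrable
      rw [uIcc_of_le hsy.le]
      exact hcont.mono (Icc_subset_Icc le_rfl hyt.le)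
    · apply Continuous.intervalIntegrable
      fun_prop
    · intro u hu
      exact le_parabola_of_concaveOn_deriv hsy hyt hcont hderiv hg hgy hu
  have hval : ∫ u in s..y, (D y + (D s - D y) * ((y - u) / (y - s)) ^ 2)
      = (y - s) * (2 * D y + D s) / 3 := by
    have : ∀ u ∈ uIcc s y, HasDerivAt
        (fun u => D y * u - (D s - D y) / (y - s) ^ 2 * (y - u) ^ 3 / 3)
        (D y + (D s - D y) * ((y - u) / (y - s)) ^ 2) u := by
      intro u _
      have h1 := (((hasDerivAt_id u).const_sub y).pow 3).const_mul ((D s - D y) / (y - s) ^ 2)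
      have h2 := ((hasDerivAt_id u).const_mul (D y)).sub (h1.div_const 3)
      refine h2.congr_deriv ?_
      simp only [id]
      field_simp
      ring
    rw [intervalIntegral.integral_eq_sub_of_hasDerivAt this
      (by apply Continuous.intervalIntegrable; fun_prop)]
    field_simp
    ring
  have h3 := hint y hy
  rw [hval] at hle
  have h4 : A * (y - s) ≤ (2 * D y + D s) / 3 * (y - s) := by linarith
  have h5 := le_of_mul_le_mul_right h4 hys
  linarith

/-- Upper bound for a function with concave derivative in terms of its values at the end points
and its integrals over final segments. -/
theorem upper_bound_of_concaveOn_deriv {D g : ℝ → ℝ} {s t A B : ℝ}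
    (hcont : ContinuousOn D (Icc s t)) (hderiv : ∀ x ∈ Ioo s t, HasDerivAt D (g x) x)
    (hg : ConcaveOn ℝ (Ioo s t) g) (hsB : D s ≤ B) (hAt : A ≤ D t) (htB : D t ≤ B)
    (hint : ∀ x ∈ Icc s t, ∫ u in x..t, D u ≤ B * (t - x)) {x : ℝ} (hx : x ∈ Icc s t) :
    D x ≤ 3 / 2 * B - 1 / 2 * A := by
  have hmem : ∀ {u}, u ∈ Icc s t → s + t - u ∈ Icc s t := fun {u} hu =>
    ⟨by linarith [hu.2], by linarith [hu.1]⟩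
  have hmem' : ∀ {u}, u ∈ Ioo s t → s + t - u ∈ Ioo s t := fun {u} hu =>
    ⟨by linarith [hu.2], by linarith [hu.1]⟩
  -- Reflecting u ↦ s + t - u and changing the sign of D leaves the derivative concave; A and B
  -- become -B and -A.
  have key := lower_bound_of_concaveOn_deriv (D := fun u => - D (s + t - u))
    (g := fun u => g (s + t - u)) (s := s) (t := t) (A := -B) (B := -A) (x := s + t - x)
    (ContinuousOn.neg (hcont.comp (by fun_prop) (fun u hu => hmem hu)))
    (fun u hu => by
      have h1 := (hderiv _ (hmem' hu)).comp u ((hasDerivAt_id u).const_sub (s + t))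
      exact h1.neg.congr_deriv (by simp))
    ⟨convex_Ioo s t, fun u hu v hv a b ha hb hab => by
      have := hg.2 (hmem' hu) (hmem' hv) ha hb hab
      simp only [smul_eq_mul] at this ⊢
      convert this using 2
      linear_combination (-(s + t)) * hab⟩
    (by simpa using htB) (by simpa using hAt) (by simpa using hsB)
    (fun u hu => by
      have h1 := hint _ (hmem hu)
      simp only [intervalIntegral.integral_neg]
      rw [intervalIntegral.integral_comp_sub_left (fun v => D v) (s + t)]
      simp only [add_sub_cancel_left]
      linarith) (hmem hx)
  simp at key
  linarith

/-! ### The cone of convex integrable functions -/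

theorem not_integrableOn_Ici_of_le_abs {f : ℝ → ℝ} {a c : ℝ} (hc : 0 < c)
    (h : ∀ x, a ≤ x → c ≤ |f x|) : ¬ IntegrableOn f (Ici a) := by
  intro hf
  have h1 : IntegrableOn (fun _ : ℝ => c) (Ici a) := by
    refine Integrable.mono' hf.abs aestronglyMeasurable_const ?_
    filter_upwards [ae_restrict_mem measurableSet_Ici] with x hx
    rw [Real.norm_of_nonneg hc.le]
    exact h x hx
  rw [integrableOn_const_iff] at h1
  simp [hc.ne'] at h1

theorem ConvexOn.add_slope_mul_le {f : ℝ → ℝ} {S : Set ℝ} (hf : ConvexOn ℝ S f) {x y z : ℝ}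
    (hx : x ∈ S) (hz : z ∈ S) (hxy : x < y) (hyz : y ≤ z) :
    f y + (f y - f x) / (y - x) * (z - y) ≤ f z := by
  rcases eq_or_lt_of_le hyz with rfl | hyz
  · simp
  have h := hf.slope_mono_adjacent hx hz hxy hyz
  have hzy : 0 < z - y := by linarith
  rw [le_div_iff₀ hzy] at h
  linarith

/-- A single increase propagates by convexity into a lower bound by a line of positive slope, which
is incompatible with integrability. -/
theorem antitoneOn_of_mem_convexIntegrableCone {f : ℝ → ℝ} (hf : f ∈ convexIntegrableCone) :
    AntitoneOn f (Ici 0) := by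
  intro x hx y hy hxy
  by_contra! hlt
  have hxy' : x < y := lt_of_le_of_ne hxy (by rintro rfl; exact lt_irrefl _ hlt)
  set σ := (f y - f x) / (y - x) with hσ
  have hσpos : 0 < σ := div_pos (by linarith) (by linarith)
  have hx0 : (0 : ℝ) ≤ x := hx
  refine not_integrableOn_Ici_of_le_abs (f := f) (a := y + (1 + |f y|) / σ) one_pos ?_
    (hf.2.mono_set (Ici_subset_Ici.2 ?_))
  · intro z hz
    have h0 : 0 ≤ (1 + |f y|) / σ := by positivity
    have h1 := hf.1.add_slope_mul_le hx (show z ∈ Ici 0 by simp; linarith) hxy'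
      (show y ≤ z by linarith)
    rw [← hσ] at h1
    have h2 : 1 + |f y| ≤ σ * (z - y) := by
      rw [mul_comm, ← div_le_iff₀ hσpos]; linarith
    have := neg_abs_le (f y)
    exact le_trans (by linarith) (le_abs_self _)
  · have h0 : 0 ≤ (1 + |f y|) / σ := by positivity
    linarith

theorem nonneg_of_mem_convexIntegrableCone {f : ℝ → ℝ} (hf : f ∈ convexIntegrableCone)
    {x : ℝ} (hx : 0 ≤ x) : 0 ≤ f x := by
  by_contra! hlt
  refine not_integrableOn_Ici_of_le_abs (f := f) (a := x) (neg_pos.2 hlt) ?_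
    (hf.2.mono_set (Ici_subset_Ici.2 hx))
  intro z hz
  have := antitoneOn_of_mem_convexIntegrableCone hf hx (show z ∈ Ici 0 from hx.trans hz) hz
  exact le_trans (by linarith) (neg_le_abs _)

theorem IsConvexDensity.mem_convexIntegrableCone {f : ℝ → ℝ} (hf : IsConvexDensity f) :
    f ∈ convexIntegrableCone := ⟨hf.convexOn, hf.integrableOn⟩

theorem add_mem_convexIntegrableCone {f g : ℝ → ℝ} (hf : f ∈ convexIntegrableCone)
    (hg : g ∈ convexIntegrableCone) : f + g ∈ convexIntegrableCone :=
  ⟨hf.1.add hg.1, hf.2.add hg.2⟩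

theorem add_smul_mem_convexIntegrableCone {f d : ℝ → ℝ} (hf : f ∈ convexIntegrableCone)
    (hd : f + d ∈ convexIntegrableCone) {τ : ℝ} (h0 : 0 ≤ τ) (h1 : τ ≤ 1) :
    (fun x => f x + τ * d x) ∈ convexIntegrableCone := by
  have : (fun x => f x + τ * d x) = (1 - τ) • f + τ • (f + d) := by
    ext x; simp; ring
  rw [this]
  exact ⟨(hf.1.smul (by linarith)).add (hd.1.smul h0), (hf.2.smul _).add (hd.2.smul _)⟩

theorem ConvexOn.continuousAt_of_pos {f : ℝ → ℝ} (hf : ConvexOn ℝ (Ici 0) f) {x : ℝ} (hx : 0 < x) :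
    ContinuousAt f x := by
  have := hf.continuousOn_interior
  rw [interior_Ici] at this
  exact this.continuousAt (Ioi_mem_nhds hx)

/-- Existence of a subgradient at an interior point. -/
theorem ConvexOn.exists_subgradient {f : ℝ → ℝ} (hf : ConvexOn ℝ (Ici 0) f) {z : ℝ} (hz : 0 < z) :
    ∃ m, ∀ x, 0 ≤ x → f z + m * (x - z) ≤ f x := by
  have hzi : z ∈ interior (Ici (0 : ℝ)) := by rw [interior_Ici]; exact hz
  refine ⟨derivWithin f (Ioi z) z, fun x hx => ?_⟩
  rcases lt_trichotomy x z with h | rfl | h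
  · have h1 := hf.leftDeriv_le_rightDeriv_of_mem_interior hzi
    have h2 := hf.slope_le_leftDeriv_of_mem_interior hx hzi h
    have h3 := h2.trans h1
    rw [slope_def_field, div_le_iff₀ (by linarith)] at h3
    linarith
  · simp
  · have h3 := hf.rightDeriv_le_slope_of_mem_interior hzi (show x ∈ Ici 0 from hx) h
    rw [slope_def_field, le_div_iff₀ (by linarith)] at h3
    linarith

/-! ### Cutting a convex function along a tangent -/

/-- The part of `f` left of `z`: `f` minus its tangent with slope `m` at `z`, cut off at `z`. -/
noncomputable def leftPart (f : ℝ → ℝ) (m z x : ℝ) : ℝ :=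
  (Iic z).indicator (fun u => f u - f z - m * (u - z)) x

theorem leftPart_of_le {f : ℝ → ℝ} {m z x : ℝ} (h : x ≤ z) :
    leftPart f m z x = f x - f z - m * (x - z) := by
  simp [leftPart, h]

theorem leftPart_of_ge {f : ℝ → ℝ} {m z x : ℝ} (h : z ≤ x) : leftPart f m z x = 0 := by
  rcases eq_or_lt_of_le h with rfl | h
  · simp [leftPart]
  · simp [leftPart, h]

theorem leftPart_eq_comp_min {f : ℝ → ℝ} {m z x : ℝ} :
    leftPart f m z x = f (min x z) - f z - m * (min x z - z) := by
  rcases le_total x z with h | h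
  · rw [leftPart_of_le h, min_eq_left h]
  · rw [leftPart_of_ge h, min_eq_right h]; ring

section LeftPart

variable {f : ℝ → ℝ} {m z : ℝ}

theorem ConvexOn.sub_tangent (hf : ConvexOn ℝ (Ici 0) f) :
    ConvexOn ℝ (Ici 0) (fun u => f u - f z - m * (u - z)) := by
  refine ⟨hf.1, fun x hx y hy a b ha hb hab => ?_⟩
  have := hf.2 hx hy ha hb hab
  simp only [smul_eq_mul] at this ⊢
  linear_combination this + (f z - m * z) * hab

/-- On [0, z] the function f minus its tangent is convex and nonincreasing, so its composition with
the concave map x ↦ min x z is convex. -/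
theorem ConvexOn.leftPart (hf : ConvexOn ℝ (Ici 0) f) (hz : 0 < z)
    (hm : ∀ x, 0 ≤ x → f z + m * (x - z) ≤ f x) :
    ConvexOn ℝ (Ici 0) (leftPart f m z) := by
  have himg : (fun x : ℝ => min x z) '' Ici 0 = Icc 0 z := by
    ext u; constructor
    · rintro ⟨x, hx, rfl⟩
      exact ⟨le_min hx hz.le, min_le_right _ _⟩
    · rintro ⟨h0, h1⟩
      exact ⟨u, h0, min_eq_left h1⟩
  have hk : ConvexOn ℝ (Ici 0) (fun u => f u - f z - m * (u - z)) := hf.sub_tangent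
  have h := ConvexOn.comp_concaveOn (s := Ici (0 : ℝ)) (f := fun x : ℝ => min x z)
    (g := fun u => f u - f z - m * (u - z))
    (by rw [himg]; exact hk.subset Icc_subset_Ici_self (convex_Icc 0 z))
    ((concaveOn_id (convex_Ici 0)).inf (concaveOn_const z (convex_Ici 0)))
    (by
      rw [himg]
      intro x hx y hy hxy
      rcases eq_or_lt_of_le hxy with rfl | hxy
      · exact le_rfl
      by_contra! hlt
      have h1 := hk.add_slope_mul_le (x := x) (y := y) (z := z) hx.1 hz.le hxy hy.2
      have h2 := hm x hx.1
      have h3 : 0 ≤ (f y - f z - m * (y - z) - (f x - f z - m * (x - z))) / (y - x) * (z - y) :=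
        mul_nonneg (div_nonneg (by linarith) (by linarith)) (by linarith [hy.2])
      simp only [sub_self, mul_zero] at h1
      linarith)
  refine h.congr fun x _ => ?_
  simp [leftPart_eq_comp_min]

/-- The counterpart with x ↦ max x z, on whose range f minus its tangent is nondecreasing; the
tangent is then added back. -/
theorem ConvexOn.sub_leftPart (hf : ConvexOn ℝ (Ici 0) f) (hz : 0 < z)
    (hm : ∀ x, 0 ≤ x → f z + m * (x - z) ≤ f x) :
    ConvexOn ℝ (Ici 0) (fun x => f x - _root_.leftPart f m z x) := by
  have himg : (fun x : ℝ => max x z) '' Ici 0 = Ici z := by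
    ext u; constructor
    · rintro ⟨x, hx, rfl⟩
      exact _root_.le_max_right x z
    · intro h
      exact ⟨u, hz.le.trans h, max_eq_left h⟩
  have hk : ConvexOn ℝ (Ici 0) (fun u => f u - f z - m * (u - z)) := hf.sub_tangent
  have h := ConvexOn.comp (s := Ici (0 : ℝ)) (f := fun x : ℝ => max x z)
    (g := fun u => f u - f z - m * (u - z))
    (by rw [himg]; exact hk.subset (Ici_subset_Ici.2 hz.le) (convex_Ici z))
    ((convexOn_id (convex_Ici 0)).sup (convexOn_const z (convex_Ici 0)))
    (by
      rw [himg]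
      intro x hx y hy hxy
      rcases eq_or_lt_of_le hxy with rfl | hxy
      · exact le_rfl
      rcases eq_or_lt_of_le (show z ≤ x from hx) with rfl | hzx
      · have := hm y (hz.le.trans hy)
        simp only [sub_self, mul_zero]
        linarith
      have h1 := hk.add_slope_mul_le (x := z) (y := x) (z := y) hz.le (hz.le.trans hy) hzx hxy.le
      have h2 := hm x (hz.le.trans hx)
      simp only [sub_self, mul_zero] at h1
      have h3 : 0 ≤ (f x - f z - m * (x - z) - 0) / (x - z) * (y - x) :=
        mul_nonneg (div_nonneg (by linarith) (by linarith)) (by linarith)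
      linarith)
  have haff : ConvexOn ℝ (Ici (0 : ℝ)) (fun u => f z + m * (u - z)) := by
    refine ⟨convex_Ici 0, fun x hx y hy a b ha hb hab => ?_⟩
    simp only [smul_eq_mul]
    linear_combination (- f z + m * z) * hab
  refine (h.add haff).congr fun x _ => ?_
  rcases le_total x z with h | h
  · simp [leftPart_of_le h, h]
    ring
  · simp [leftPart_of_ge h, h]

theorem integrableOn_leftPart (hf : IntegrableOn f (Ici 0)) :
    IntegrableOn (leftPart f m z) (Ici 0) := by
  have h1 : IntegrableOn (fun u => f u - f z - m * (u - z)) (Icc 0 z) := by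
    have h2 : IntegrableOn (fun u => - f z - m * (u - z)) (Icc 0 z) :=
      (by fun_prop : Continuous fun u => - f z - m * (u - z)).integrableOn_Icc
    refine ((hf.mono_set Icc_subset_Ici_self).add h2).congr_fun ?_ measurableSet_Icc
    intro u _
    simp; ring
  have h3 : leftPart f m z = (Iic z).indicator (fun u => f u - f z - m * (u - z)) := rfl
  rw [h3, IntegrableOn, integrable_indicator_iff measurableSet_Iic, IntegrableOn,
    Measure.restrict_restrict measurableSet_Iic]
  refine IntegrableOn.mono_set h1 ?_
  intro x hx
  exact ⟨hx.2, hx.1⟩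

end LeftPart

/-! ### First order conditions and the score -/

/-- The linear functional `φ ↦ ∫ a φ dx - ∫ w φ d𝔽`, the directional derivative of the estimation
criteria up to constant factors. -/
noncomputable def scoreFunctional {n : ℕ} (X : Fin n → ℝ) (a w φ : ℝ → ℝ) : ℝ :=
  (∫ x in Ici (0 : ℝ), a x * φ x) - empiricalIntegral X (fun x => w x * φ x)

/-- `f` satisfies the first order conditions for optimality with respect to the functional
with weights `a` and `w`. -/
structure IsCritical {n : ℕ} (X : Fin n → ℝ) (f a w : ℝ → ℝ) : Prop where
  sample_nonneg : ∀ i, 0 ≤ X i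
  mem : f ∈ convexIntegrableCone
  nonneg : ∀ x, 0 ≤ x → 0 ≤ a x
  continuousOn : ContinuousOn a (Ioi 0)
  integrable_mul : ∀ φ : ℝ → ℝ, IntegrableOn φ (Ici 0) → IntegrableOn (fun x => a x * φ x) (Ici 0)
  weight_pos : ∀ i, 0 < w (X i)
  score_nonneg : ∀ g ∈ convexIntegrableCone, 0 ≤ scoreFunctional X a w (fun x => g x - f x)

/-- The weighted empirical distribution function. -/
noncomputable def weightedCDF {n : ℕ} (X : Fin n → ℝ) (w : ℝ → ℝ) (x : ℝ) : ℝ :=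
  empiricalIntegral X (fun u => w u * (Iic x).indicator 1 u)

/-- The difference of the distribution function with density `a` and the weighted empirical
distribution function. -/
noncomputable def scoreCDF {n : ℕ} (X : Fin n → ℝ) (a w : ℝ → ℝ) (x : ℝ) : ℝ :=
  densityCDF a x - weightedCDF X w x

/-- The primitive of `scoreCDF`. -/
noncomputable def scorePrimitive {n : ℕ} (X : Fin n → ℝ) (a w : ℝ → ℝ) (x : ℝ) : ℝ :=
  ∫ u in (0 : ℝ)..x, scoreCDF X a w u

theorem integrableOn_indicator_Iic {φ : ℝ → ℝ} {z : ℝ} (h : IntegrableOn φ (Icc 0 z)) :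
    IntegrableOn ((Iic z).indicator φ) (Ici 0) := by
  rw [IntegrableOn, integrable_indicator_iff measurableSet_Iic, IntegrableOn,
    Measure.restrict_restrict measurableSet_Iic]
  exact IntegrableOn.mono_set h fun x hx => ⟨hx.2, hx.1⟩

theorem setIntegral_Ici_indicator_Iic {φ : ℝ → ℝ} {z : ℝ} (hz : 0 ≤ z) :
    ∫ x in Ici (0 : ℝ), (Iic z).indicator φ x = ∫ x in (0 : ℝ)..z, φ x := by
  rw [setIntegral_indicator measurableSet_Iic, Ici_inter_Iic, integral_Icc_eq_integral_Ioc,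
    intervalIntegral.integral_of_le hz]

theorem max_sub_zero_eq_indicator (z : ℝ) :
    (fun x => max (z - x) 0) = (Iic z).indicator (fun x => z - x) := by
  ext x
  rcases le_or_gt x z with h | h
  · simp [h]
  · simp [h, h.le]

theorem integrableOn_max_sub_zero (z : ℝ) : IntegrableOn (fun x => max (z - x) 0) (Ici 0) := by
  rw [max_sub_zero_eq_indicator]
  exact integrableOn_indicator_Iic (by fun_prop : Continuous fun x => z - x).integrableOn_Icc

theorem max_sub_zero_mem_convexIntegrableCone (z : ℝ) :
    (fun x => max (z - x) 0) ∈ convexIntegrableCone := by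
  refine ⟨?_, integrableOn_max_sub_zero z⟩
  exact ((convexOn_const z (convex_Ici 0)).sub (concaveOn_id (convex_Ici 0))).sup
    (convexOn_const 0 (convex_Ici 0))

/-- To the left of z - ε the difference of the two left parts is the difference of two tangents. It
has slope -M, where M is the increment of m, and vanishes at a crossing point within ε of z, so it
is M(z - x) up to Mε. That the error carries the factor M is what `subgradient_eq` exploits. -/
theorem abs_max_sub_leftPart_sub_le {f : ℝ → ℝ} {m : ℝ → ℝ}
    (hm : ∀ z, 0 < z → ∀ x, 0 ≤ x → f z + m z * (x - z) ≤ f x) {z ε : ℝ} (hε : 0 < ε) (hεz : ε < z)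
    (hM : 0 ≤ m (z + ε) - m (z - ε)) {x : ℝ} (hx : 0 ≤ x) :
    |(m (z + ε) - m (z - ε)) * max (z - x) 0
      - (leftPart f (m (z + ε)) (z + ε) x - leftPart f (m (z - ε)) (z - ε) x)|
      ≤ (m (z + ε) - m (z - ε)) * ε * (Iic (z + ε)).indicator 1 x := by
  have ha0 : 0 < z - ε := by linarith
  have hb0 : 0 < z + ε := by linarith
  rcases le_or_gt x (z + ε) with hxb | hxb
  swap
  · have h1 : max (z - x) 0 = 0 := max_eq_right (by linarith)
    rw [leftPart_of_ge hxb.le, leftPart_of_ge (by linarith), h1]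
    simp [hxb]
  have hind : (Iic (z + ε)).indicator (1 : ℝ → ℝ) x = 1 := by simp [hxb]
  rw [hind, mul_one, leftPart_of_le hxb]
  have hab := hm _ ha0 _ hb0.le
  have hba := hm _ hb0 _ ha0.le
  rcases le_total x (z - ε) with hxa | hxa
  · rw [leftPart_of_le hxa, max_eq_left (by linarith), abs_le]
    constructor <;> nlinarith
  · rw [leftPart_of_ge hxa]
    have hx0 : 0 < x := by linarith
    have h1 := hm _ ha0 _ hx
    have h2 := hm _ hb0 _ hx
    have h3 := hm _ hx0 _ ha0.le
    have h4 := hm _ hx0 _ hb0.le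
    have hmx : 0 ≤ (m x - m (z - ε)) * (x - (z - ε)) := by linarith
    have h5 : (m x - m (z - ε)) * (z + ε - x) ≥ 0 := by
      rcases eq_or_lt_of_le hxa with h | h
      · rw [← h]; simp
      · exact mul_nonneg (nonneg_of_mul_nonneg_left hmx (by linarith)) (by linarith)
    rw [abs_le]
    rcases le_total x z with hxz | hxz
    · rw [max_eq_left (by linarith)]
      constructor <;> nlinarith
    · rw [max_eq_right (by linarith)]
      constructor <;> nlinarith

/-! ### Empirical integrals and weighted distribution functions -/

section Empirical

variable {n : ℕ} (X : Fin n → ℝ)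

theorem empiricalIntegral_add (φ ψ : ℝ → ℝ) :
    empiricalIntegral X (fun x => φ x + ψ x) = empiricalIntegral X φ + empiricalIntegral X ψ := by
  simp [empiricalIntegral, Finset.sum_add_distrib, add_div]

theorem empiricalIntegral_const_mul (c : ℝ) (φ : ℝ → ℝ) :
    empiricalIntegral X (fun x => c * φ x) = c * empiricalIntegral X φ := by
  simp [empiricalIntegral, ← Finset.mul_sum, mul_div_assoc]

variable {X}

theorem empiricalIntegral_congr {φ ψ : ℝ → ℝ} (h : ∀ i, φ (X i) = ψ (X i)) :
    empiricalIntegral X φ = empiricalIntegral X ψ := by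
  simp [empiricalIntegral, h]

theorem empiricalIntegral_mono {φ ψ : ℝ → ℝ} (h : ∀ i, φ (X i) ≤ ψ (X i)) :
    empiricalIntegral X φ ≤ empiricalIntegral X ψ :=
  div_le_div_of_nonneg_right (Finset.sum_le_sum fun i _ => h i) (Nat.cast_nonneg n)

theorem empiricalCDF_eq_empiricalIntegral (x : ℝ) :
    empiricalCDF X x = empiricalIntegral X ((Iic x).indicator 1) := by
  simp [empiricalCDF, empiricalIntegral, indicator_apply]

theorem empiricalCDF_eq_weightedCDF (x : ℝ) : empiricalCDF X x = weightedCDF X (fun _ => 1) x := by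
  simp [empiricalCDF_eq_empiricalIntegral, weightedCDF]

variable {w : ℝ → ℝ}

theorem weightedCDF_monotone (hw : ∀ i, 0 ≤ w (X i)) : Monotone (weightedCDF X w) := by
  intro x y hxy
  refine empiricalIntegral_mono fun i => mul_le_mul_of_nonneg_left ?_ (hw i)
  exact indicator_le_indicator_of_subset (Iic_subset_Iic.2 hxy) (fun _ => zero_le_one) _

theorem weightedCDF_nonneg (hw : ∀ i, 0 ≤ w (X i)) (x : ℝ) : 0 ≤ weightedCDF X w x := by
  refine div_nonneg (Finset.sum_nonneg fun i _ => mul_nonneg (hw i) ?_) (Nat.cast_nonneg n)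
  exact indicator_nonneg (fun _ _ => zero_le_one) _

theorem continuousWithinAt_weightedCDF (x : ℝ) :
    ContinuousWithinAt (weightedCDF X w) (Ici x) x := by
  have h1 : ∀ u : ℝ, ContinuousWithinAt (fun y => (Iic y).indicator (1 : ℝ → ℝ) u) (Ici x) x := by
    intro u
    refine continuousWithinAt_const.congr_of_eventuallyEq
      (f := fun _ => (Iic x).indicator (1 : ℝ → ℝ) u) ?_ rfl
    rcases le_or_gt u x with h | h
    · filter_upwards [self_mem_nhdsWithin] with y hy
      simp [h, h.trans hy]
    · filter_upwards [mem_nhdsWithin_of_mem_nhds (Iio_mem_nhds h)] with y hy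
      simp [h, show y < u from hy]
  unfold weightedCDF empiricalIntegral
  refine ContinuousWithinAt.div_const ?_ _
  exact tendsto_finsetSum _ fun i _ => continuousWithinAt_const.mul (h1 (X i))

theorem integral_indicator_Iic {u z : ℝ} (hu : 0 ≤ u) (hz : 0 ≤ z) :
    ∫ x in (0 : ℝ)..z, (Iic x).indicator (1 : ℝ → ℝ) u = max (z - u) 0 := by
  have h : ∀ x, (Iic x).indicator (1 : ℝ → ℝ) u = (Ici u).indicator (fun _ => (1 : ℝ)) x := by
    intro x; simp [indicator_apply]
  simp only [h]
  rw [intervalIntegral.integral_of_le hz, setIntegral_indicator measurableSet_Ici,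
    setIntegral_const, smul_eq_mul, mul_one]
  rcases le_or_gt u 0 with h0 | h0
  · have : u = 0 := le_antisymm h0 hu
    subst this
    have : Ioc 0 z ∩ Ici 0 = Ioc 0 z := inter_eq_left.2 fun x hx => hx.1.le
    rw [this, Real.volume_real_Ioc]
  · have : Ioc 0 z ∩ Ici u = Icc u z := by
      ext x; constructor
      · rintro ⟨h1, h2⟩; exact ⟨h2, h1.2⟩
      · rintro ⟨h1, h2⟩; exact ⟨⟨h0.trans_le h1, h2⟩, h1⟩
    rw [this, Real.volume_real_Icc]

theorem intervalIntegrable_indicator_Iic (u x y : ℝ) :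
    IntervalIntegrable (fun z => (Iic z).indicator (1 : ℝ → ℝ) u) volume x y := by
  refine Monotone.intervalIntegrable fun a b hab => ?_
  exact indicator_le_indicator_of_subset (Iic_subset_Iic.2 hab) (fun _ => zero_le_one) _

theorem integral_weightedCDF (hX : ∀ i, 0 ≤ X i) {z : ℝ} (hz : 0 ≤ z) :
    ∫ x in (0 : ℝ)..z, weightedCDF X w x = empiricalIntegral X (fun x => w x * max (z - x) 0) := by
  unfold weightedCDF empiricalIntegral
  rw [intervalIntegral.integral_div, intervalIntegral.integral_finsetSum]
  · congr 1
    refine Finset.sum_congr rfl fun i _ => ?_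
    rw [intervalIntegral.integral_const_mul, integral_indicator_Iic (hX i) hz]
  · intro i _
    exact (intervalIntegrable_indicator_Iic _ _ _).const_mul _

end Empirical

/-- A primitive of an integrable function that is continuous on `(0, ∞)`. -/
theorem hasDerivAt_densityCDF {a : ℝ → ℝ} (ha : ∀ x, 0 ≤ x → IntervalIntegrable a volume 0 x)
    (hc : ContinuousOn a (Ioi 0)) {x : ℝ} (hx : 0 < x) : HasDerivAt (densityCDF a) (a x) x := by
  refine intervalIntegral.integral_hasDerivAt_right (ha x hx.le) ?_
    (hc.continuousAt (Ioi_mem_nhds hx))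
  exact hc.stronglyMeasurableAtFilter isOpen_Ioi x hx

theorem continuousOn_densityCDF {a : ℝ → ℝ} (ha : ∀ x, 0 ≤ x → IntervalIntegrable a volume 0 x)
    (z : ℝ) : ContinuousOn (densityCDF a) (Icc 0 z) := by
  rcases le_or_gt 0 z with hz | hz
  · have hint : IntegrableOn a (uIcc 0 z) volume := by
      rw [uIcc_of_le hz]
      exact (intervalIntegrable_iff_integrableOn_Icc_of_le hz).1 (ha z hz)
    have h : ContinuousOn (densityCDF a) (uIcc 0 z) :=
      intervalIntegral.continuousOn_primitive_interval hint
    rwa [uIcc_of_le hz] at h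
  · simp [Icc_eq_empty hz.not_ge]

/-! ### Consequences of the first order conditions -/

namespace IsCritical

variable {n : ℕ} {X : Fin n → ℝ} {f a w : ℝ → ℝ}

theorem scoreFunctional_add (h : IsCritical X f a w) {φ ψ : ℝ → ℝ} (hφ : IntegrableOn φ (Ici 0))
    (hψ : IntegrableOn ψ (Ici 0)) :
    scoreFunctional X a w (fun x => φ x + ψ x)
      = scoreFunctional X a w φ + scoreFunctional X a w ψ := by
  unfold scoreFunctional
  simp only [mul_add]
  rw [integral_add (h.integrable_mul φ hφ) (h.integrable_mul ψ hψ),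
    empiricalIntegral_add X (fun x => w x * φ x) (fun x => w x * ψ x)]
  ring

theorem _root_.scoreFunctional_const_mul (c : ℝ) (φ : ℝ → ℝ) :
    scoreFunctional X a w (fun x => c * φ x) = c * scoreFunctional X a w φ := by
  unfold scoreFunctional
  simp only [mul_left_comm _ c]
  rw [integral_const_mul, empiricalIntegral_const_mul]
  ring

theorem weight_nonneg (h : IsCritical X f a w) (i : Fin n) : 0 ≤ w (X i) := (h.weight_pos i).le

theorem intervalIntegrable (h : IsCritical X f a w) (x : ℝ) (hx : 0 ≤ x) :
    IntervalIntegrable a volume 0 x := by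
  have h1 := h.integrable_mul ((Iic x).indicator 1)
    (integrableOn_indicator_Iic continuous_one.integrableOn_Icc)
  rw [intervalIntegrable_iff_integrableOn_Icc_of_le hx]
  refine (h1.mono_set Icc_subset_Ici_self).congr_fun ?_ measurableSet_Icc
  intro u hu
  simp [hu.2]

theorem integral_mul_indicator {φ : ℝ → ℝ} {z : ℝ} (hz : 0 ≤ z) :
    ∫ x in Ici (0 : ℝ), a x * (Iic z).indicator φ x = ∫ x in (0 : ℝ)..z, a x * φ x := by
  rw [← setIntegral_Ici_indicator_Iic hz]
  congr 1; ext x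
  simp [indicator_apply]

theorem scoreFunctional_indicator {x : ℝ} (hx : 0 ≤ x) :
    scoreFunctional X a w ((Iic x).indicator 1) = scoreCDF X a w x := by
  unfold scoreFunctional scoreCDF weightedCDF densityCDF
  rw [integral_mul_indicator hx]
  simp

theorem intervalIntegrable_scoreCDF (h : IsCritical X f a w) {x y : ℝ} (hx : 0 ≤ x) (hy : 0 ≤ y) :
    IntervalIntegrable (scoreCDF X a w) volume x y := by
  have h1 : ∀ z, 0 ≤ z → IntervalIntegrable (scoreCDF X a w) volume 0 z := by
    intro z hz
    refine IntervalIntegrable.sub (ContinuousOn.intervalIntegrable ?_)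
      (weightedCDF_monotone h.weight_nonneg).intervalIntegrable
    rw [uIcc_of_le hz]
    exact continuousOn_densityCDF h.intervalIntegrable z
  exact (h1 x hx).symm.trans (h1 y hy)

/-- For each of the two measures in L, the integral of (z - x)₊ is the integral over [0, z] of the
distribution function. -/
theorem scoreFunctional_max_sub_zero (h : IsCritical X f a w) {z : ℝ} (hz : 0 ≤ z) :
    scoreFunctional X a w (fun x => max (z - x) 0) = scorePrimitive X a w z := by
  have hcont := continuousOn_densityCDF h.intervalIntegrable z
  have hparts : ∫ x in (0 : ℝ)..z, (z - x) * a x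
      = (z - z) * densityCDF a z - (z - 0) * densityCDF a 0
        - ∫ x in (0 : ℝ)..z, (-1) * densityCDF a x := by
    refine intervalIntegral.integral_mul_deriv_eq_deriv_mul_of_hasDeriv_right
      (u := fun x => z - x) (u' := fun _ => -1) (by fun_prop) (by rwa [uIcc_of_le hz])
      (fun x _ => ?_) (fun x hx => ?_) intervalIntegrable_const (h.intervalIntegrable z hz)
    · exact ((hasDerivAt_id x).const_sub z).hasDerivWithinAt
    · rw [min_eq_left hz] at hx
      exact (hasDerivAt_densityCDF h.intervalIntegrable h.continuousOn hx.1).hasDerivWithinAt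
  have h0 : densityCDF a 0 = 0 := by simp [densityCDF]
  have h1 : ∫ x in Ici (0 : ℝ), a x * max (z - x) 0 = ∫ x in (0 : ℝ)..z, densityCDF a x := by
    have h2 := integral_mul_indicator (a := a) (φ := fun x => z - x) hz
    rw [← max_sub_zero_eq_indicator] at h2
    rw [h2]
    simp only [mul_comm (a _)]
    rw [hparts, h0, intervalIntegral.integral_const_mul]
    ring
  unfold scoreFunctional scorePrimitive scoreCDF
  rw [h1, ← integral_weightedCDF h.sample_nonneg hz, ← intervalIntegral.integral_sub]
  · apply ContinuousOn.intervalIntegrable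
    rwa [uIcc_of_le hz]
  · exact (weightedCDF_monotone h.weight_nonneg).intervalIntegrable

theorem scorePrimitive_nonneg (h : IsCritical X f a w) {z : ℝ} (hz : 0 ≤ z) :
    0 ≤ scorePrimitive X a w z := by
  have h1 := h.score_nonneg _
    (add_mem_convexIntegrableCone h.mem (max_sub_zero_mem_convexIntegrableCone z))
  simp only [Pi.add_apply, add_sub_cancel_left] at h1
  rwa [h.scoreFunctional_max_sub_zero hz] at h1

theorem continuousOn_scorePrimitive (h : IsCritical X f a w) (z : ℝ) :
    ContinuousOn (scorePrimitive X a w) (Icc 0 z) :=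
  continuousOn_densityCDF (fun _ hx => h.intervalIntegrable_scoreCDF le_rfl hx) z

/-- G may jump at the observations but is right-continuous, so only a right derivative is available.
-/
theorem hasDerivWithinAt_scorePrimitive (h : IsCritical X f a w) {x : ℝ} (hx : 0 ≤ x) :
    HasDerivWithinAt (scorePrimitive X a w) (scoreCDF X a w x) (Ici x) x := by
  have hcont : ContinuousWithinAt (scoreCDF X a w) (Ici x) x := by
    refine ContinuousWithinAt.sub ?_ (continuousWithinAt_weightedCDF x)
    refine (continuousOn_densityCDF h.intervalIntegrable (x + 1) x
      ⟨hx, by linarith⟩).mono_of_mem_nhdsWithin ?_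
    filter_upwards [self_mem_nhdsWithin, mem_nhdsWithin_of_mem_nhds
      (Iio_mem_nhds (show x < x + 1 by linarith))] with y hy hy'
    exact ⟨hx.trans hy, le_of_lt hy'⟩
  refine intervalIntegral.integral_hasDerivWithinAt_right (t := Ioi x)
    (h.intervalIntegrable_scoreCDF le_rfl hx) ?_ (hcont.mono Ioi_subset_Ici_self)
  refine ⟨Ioc x (x + 1), Ioc_mem_nhdsGT (by linarith), ?_⟩
  exact (h.intervalIntegrable_scoreCDF hx (show 0 ≤ x + 1 by linarith)).1.aestronglyMeasurable

/-- At a zero s the nonnegative H is minimal, so its right derivative G(s) is nonnegative. Since G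
jumps only downwards, G(s) > 0 would make G positive just left of s, and H negative there. -/
theorem scoreCDF_eq_zero (h : IsCritical X f a w) {s : ℝ} (hs : 0 ≤ s)
    (hs0 : scorePrimitive X a w s = 0) : scoreCDF X a w s = 0 := by
  apply le_antisymm
  · rcases eq_or_lt_of_le hs with rfl | hs'
    · have h1 : densityCDF a 0 = 0 := by simp [densityCDF]
      unfold scoreCDF
      linarith [weightedCDF_nonneg h.weight_nonneg 0]
    have hA : ContinuousAt (densityCDF a) s :=
      (hasDerivAt_densityCDF h.intervalIntegrable h.continuousOn hs').continuousAt
    -- On [x, s] the weighted empirical part is largest at s and the part from a is smallest at x,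
    -- which bounds G from below by a constant; its integral over [x, s] is at most H(s) - H(x) ≤ 0.
    have hle : ∀ x ∈ Ioo 0 s, scoreCDF X a w s ≤ densityCDF a s - densityCDF a x := by
      intro x hx
      have hmono : ∀ u ∈ Icc x s, densityCDF a x ≤ densityCDF a u := by
        intro u hu
        have := intervalIntegral.integral_interval_sub_left
          (h.intervalIntegrable u (hx.1.le.trans hu.1)) (h.intervalIntegrable x hx.1.le)
        have h2 : 0 ≤ ∫ v in x..u, a v := intervalIntegral.integral_nonneg hu.1
          fun v hv => h.nonneg v (hx.1.le.trans hv.1)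
        unfold densityCDF
        linarith
      have h1 : ∫ u in x..s, (scoreCDF X a w s - (densityCDF a s - densityCDF a x))
          ≤ ∫ u in x..s, scoreCDF X a w u := by
        refine intervalIntegral.integral_mono_on hx.2.le intervalIntegrable_const
          (h.intervalIntegrable_scoreCDF hx.1.le hs) fun u hu => ?_
        have h2 := hmono u hu
        have h3 := weightedCDF_monotone h.weight_nonneg hu.2
        unfold scoreCDF
        linarith
      have h2 := intervalIntegral.integral_interval_sub_left
        (h.intervalIntegrable_scoreCDF le_rfl hs) (h.intervalIntegrable_scoreCDF le_rfl hx.1.le)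
      have h3 := h.scorePrimitive_nonneg hx.1.le
      unfold scorePrimitive at h3 hs0
      rw [intervalIntegral.integral_const, smul_eq_mul] at h1
      have h4 : (s - x) * (scoreCDF X a w s - (densityCDF a s - densityCDF a x)) ≤ 0 := by linarith
      have := nonpos_of_mul_nonpos_right h4 (by linarith [hx.2])
      linarith
    have hlim : Tendsto (fun x => densityCDF a s - densityCDF a x) (𝓝[<] s) (𝓝 0) := by
      have := (hA.tendsto.const_sub (densityCDF a s)).mono_left
        (nhdsWithin_le_nhds (s := Iio s))
      simpa using this
    refine ge_of_tendsto hlim ?_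
    filter_upwards [Ioo_mem_nhdsLT hs'] with x hx using hle x hx
  · have h1 := (h.hasDerivWithinAt_scorePrimitive hs).Ioi_of_Ici
    rw [hasDerivWithinAt_iff_tendsto_slope' (by simp)] at h1
    refine ge_of_tendsto h1 ?_
    filter_upwards [self_mem_nhdsWithin] with x hx
    rw [slope_def_field, hs0, sub_zero]
    exact div_nonneg (h.scorePrimitive_nonneg (hs.trans (le_of_lt hx)))
      (sub_nonneg.2 (le_of_lt hx))

/-- H(0) = 0 forces G(0) = 0, whereas an observation at 0 would contribute a positive weight. -/
theorem sample_pos (h : IsCritical X f a w) (i : Fin n) : 0 < X i := by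
  have h1 := h.scoreCDF_eq_zero le_rfl (by simp [scorePrimitive])
  refine lt_of_le_of_ne (h.sample_nonneg i) fun hi => ?_
  have h2 : densityCDF a 0 = 0 := by simp [densityCDF]
  rw [scoreCDF, h2, zero_sub, neg_eq_zero] at h1
  have hn : 0 < n := Fin.pos i
  have h3 : 0 < weightedCDF X w 0 := by
    refine div_pos (Finset.sum_pos' (fun j _ => mul_nonneg (h.weight_nonneg j)
      (indicator_nonneg (fun _ _ => zero_le_one) _)) ⟨i, Finset.mem_univ i, ?_⟩) (by exact_mod_cast hn)
    simpa [← hi] using h.weight_pos i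
  linarith

theorem empiricalCDF_zero (h : IsCritical X f a w) : empiricalCDF X 0 = 0 := by
  unfold empiricalCDF
  simp [Finset.filter_false_of_mem, (h.sample_pos _).not_ge]

/-- Both f + `leftPart` and f - `leftPart` stay in the cone, so the score has both signs. -/
theorem scoreFunctional_leftPart (h : IsCritical X f a w) {m z : ℝ} (hz : 0 < z)
    (hm : ∀ x, 0 ≤ x → f z + m * (x - z) ≤ f x) :
    scoreFunctional X a w (leftPart f m z) = 0 := by
  have hint : IntegrableOn (leftPart f m z) (Ici 0) := integrableOn_leftPart h.mem.2
  apply le_antisymm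
  · have h1 := h.score_nonneg (fun x => f x - leftPart f m z x)
      ⟨h.mem.1.sub_leftPart hz hm, h.mem.2.sub hint⟩
    have h2 : (fun x => f x - leftPart f m z x - f x) = fun x => (-1) * leftPart f m z x := by
      ext x; ring
    rw [h2, scoreFunctional_const_mul] at h1
    linarith
  · have h1 := h.score_nonneg (fun x => f x + leftPart f m z x)
      ⟨h.mem.1.add (h.mem.1.leftPart hz hm), h.mem.2.add hint⟩
    simpa using h1

/-- Replacing f on [z - ε, z + ε] by its tangent at z + ε, and adjusting it by an affine function
further left, stays in the cone. The change is -M(z - x)₊ up to Mε, so 0 ≤ -M H(z) + MεC, and M = 0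
once εC < H(z). -/
theorem subgradient_eq (h : IsCritical X f a w) {m : ℝ → ℝ}
    (hm : ∀ z, 0 < z → ∀ x, 0 ≤ x → f z + m z * (x - z) ≤ f x) {z : ℝ} (hz : 0 < z)
    (hpos : 0 < scorePrimitive X a w z) :
    ∃ ε, 0 < ε ∧ ε < z ∧ m (z + ε) = m (z - ε) := by
  -- C bounds the a-mass of [0, z + ε] plus the total weight of the sample, uniformly in ε ≤ 1.
  set C := densityCDF a (z + 1) + empiricalIntegral X w with hC
  have hC0 : 0 ≤ C := by
    refine add_nonneg (intervalIntegral.integral_nonneg (by linarith) fun v hv => h.nonneg v hv.1) ?_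
    exact div_nonneg (Finset.sum_nonneg fun i _ => h.weight_nonneg i) (Nat.cast_nonneg n)
  obtain ⟨ε, hε0, hε⟩ : ∃ ε, 0 < ε ∧ ε < min (min 1 z) (scorePrimitive X a w z / (C + 1)) :=
    exists_between (lt_min (lt_min one_pos hz) (by positivity))
  rw [lt_min_iff, lt_min_iff, lt_div_iff₀ (by linarith)] at hε
  obtain ⟨⟨hε1, hεz⟩, hεH⟩ := hε
  refine ⟨ε, hε0, hεz, ?_⟩
  set M := m (z + ε) - m (z - ε) with hM
  have ha0 : 0 < z - ε := by linarith
  have hb0 : 0 < z + ε := by linarith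
  have hM0 : 0 ≤ M := by
    have hab := hm _ ha0 _ hb0.le
    have hba := hm _ hb0 _ ha0.le
    have : 0 ≤ M * (2 * ε) := by rw [hM]; linarith
    exact nonneg_of_mul_nonneg_left this (by linarith)
  set r : ℝ → ℝ := fun x => M * max (z - x) 0
    - (leftPart f (m (z + ε)) (z + ε) x - leftPart f (m (z - ε)) (z - ε) x) with hr
  have hr_le : ∀ x, 0 ≤ x → |r x| ≤ M * ε * (Iic (z + ε)).indicator 1 x := fun x hx =>
    abs_max_sub_leftPart_sub_le hm hε0 hεz hM0 hx
  have hintb : IntegrableOn (leftPart f (m (z + ε)) (z + ε)) (Ici 0) := integrableOn_leftPart h.mem.2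
  have hinta : IntegrableOn (leftPart f (m (z - ε)) (z - ε)) (Ici 0) := integrableOn_leftPart h.mem.2
  have hintφ : IntegrableOn (fun x => M * max (z - x) 0) (Ici 0) :=
    (integrableOn_max_sub_zero z).const_mul M
  have hintr : IntegrableOn r (Ici 0) := hintφ.sub (hintb.sub hinta)
  have hscore : 0 ≤ scoreFunctional X a w (fun x => r x + (-M) * max (z - x) 0) := by
    have h1 := h.score_nonneg
      (fun x => (f x - leftPart f (m (z + ε)) (z + ε) x) + leftPart f (m (z - ε)) (z - ε) x)
      ⟨(h.mem.1.sub_leftPart hb0 (hm _ hb0)).add (h.mem.1.leftPart ha0 (hm _ ha0)),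
        (h.mem.2.sub hintb).add hinta⟩
    convert h1 using 2
    ext x
    simp only [hr]
    ring
  rw [h.scoreFunctional_add hintr ((integrableOn_max_sub_zero z).const_mul (-M)),
    scoreFunctional_const_mul, h.scoreFunctional_max_sub_zero hz.le] at hscore
  have hr1 : ∫ x in Ici (0 : ℝ), a x * r x ≤ M * ε * densityCDF a (z + 1) := by
    calc ∫ x in Ici (0 : ℝ), a x * r x
        ≤ ∫ x in Ici (0 : ℝ), a x * (M * ε * (Iic (z + ε)).indicator 1 x) := by
          refine setIntegral_mono_on (h.integrable_mul r hintr) ?_ measurableSet_Ici fun x hx => ?_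
          · exact h.integrable_mul _
              ((integrableOn_indicator_Iic continuous_one.integrableOn_Icc).const_mul _)
          · exact mul_le_mul_of_nonneg_left ((le_abs_self _).trans (hr_le x hx)) (h.nonneg x hx)
      _ = M * ε * densityCDF a (z + ε) := by
          simp only [mul_left_comm (a _)]
          rw [integral_const_mul, integral_mul_indicator hb0.le]
          simp [densityCDF]
      _ ≤ M * ε * densityCDF a (z + 1) := by
          refine mul_le_mul_of_nonneg_left ?_ (by positivity)
          refine intervalIntegral.integral_mono_interval le_rfl hb0.le (by linarith) ?_
            (h.intervalIntegrable _ (by linarith))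
          filter_upwards [ae_restrict_mem measurableSet_Ioc] with x hx using h.nonneg x hx.1.le
  have hr2 : -(M * ε * empiricalIntegral X w) ≤ empiricalIntegral X (fun x => w x * r x) := by
    have : -(M * ε * empiricalIntegral X w) = empiricalIntegral X (fun x => (-(M * ε)) * w x) := by
      rw [empiricalIntegral_const_mul]; ring
    rw [this]
    refine empiricalIntegral_mono fun i => ?_
    have h1 : (Iic (z + ε)).indicator (1 : ℝ → ℝ) (X i) ≤ 1 :=
      indicator_le_self' (fun _ _ => zero_le_one) _
    have h2 : M * ε * (Iic (z + ε)).indicator (1 : ℝ → ℝ) (X i) ≤ M * ε :=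
      mul_le_of_le_one_right (by positivity) h1
    have h3 := neg_abs_le (r (X i))
    have h4 := hr_le _ (h.sample_nonneg i)
    nlinarith [h.weight_pos i]
  have hfin : M * (scorePrimitive X a w z - ε * C) ≤ 0 := by
    unfold scoreFunctional at hscore
    rw [hC]
    linarith
  have hlt : 0 < scorePrimitive X a w z - ε * C := by linarith
  have := nonpos_of_mul_nonpos_left hfin hlt
  have hM1 : M = 0 := le_antisymm this hM0
  linarith

end IsCritical

/-! ### Components of the set where the score primitive is positive -/

namespace IsCritical

variable {n : ℕ} {X : Fin n → ℝ} {f a w : ℝ → ℝ}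

/-- By `subgradient_eq` and monotonicity, any choice of subgradients is locally constant on S, hence
constant on this interval. -/
theorem exists_slope (h : IsCritical X f a w) {S : Set ℝ} (hS : S.OrdConnected) (hS0 : S ⊆ Ioi 0)
    (hpos : ∀ u ∈ S, 0 < scorePrimitive X a w u) :
    ∃ β, ∀ u ∈ S, ∀ x, 0 ≤ x → f u + β * (x - u) ≤ f x := by
  have hex : ∀ z, ∃ m, 0 < z → ∀ x, 0 ≤ x → f z + m * (x - z) ≤ f x := by
    intro z
    by_cases hz : 0 < z
    · obtain ⟨m, hm⟩ := h.mem.1.exists_subgradient hz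
      exact ⟨m, fun _ => hm⟩
    · exact ⟨0, fun h => absurd h hz⟩
  choose m hm using hex
  have hmono : ∀ x y, 0 < x → x ≤ y → m x ≤ m y := by
    intro x y hx hxy
    rcases eq_or_lt_of_le hxy with rfl | hlt
    · exact le_rfl
    have h1 := hm x hx y (hx.le.trans hxy)
    have h2 := hm y (hx.trans hlt) x hx.le
    have h3 : 0 ≤ (m y - m x) * (y - x) := by linarith
    linarith [nonneg_of_mul_nonneg_left h3 (by linarith)]
  have hderiv : ∀ v ∈ S, HasDerivAt m 0 v := by
    intro v hv
    obtain ⟨ε, hε, hεv, heq⟩ := h.subgradient_eq hm (hS0 hv) (hpos v hv)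
    refine (hasDerivAt_const v (m (v - ε))).congr_of_eventuallyEq ?_
    filter_upwards [Ioo_mem_nhds (show v - ε < v by linarith) (show v < v + ε by linarith)]
      with y hy
    have h1 := hmono (v - ε) y (by linarith) hy.1.le
    have h2 := hmono y (v + ε) (by linarith [hy.1]) hy.2.le
    linarith
  have hconst : ∀ x ∈ S, ∀ y ∈ S, x ≤ y → m y = m x := by
    intro x hx y hy hxy
    have hsub : Icc x y ⊆ S := hS.out hx hy
    exact constant_of_has_deriv_right_zero
      (fun v hv => (hderiv v (hsub hv)).continuousAt.continuousWithinAt)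
      (fun v hv => (hderiv v (hsub (Ico_subset_Icc_self hv))).hasDerivWithinAt) y ⟨hxy, le_rfl⟩
  rcases S.eq_empty_or_nonempty with rfl | ⟨u₀, hu₀⟩
  · exact ⟨0, fun u hu => absurd hu (notMem_empty u)⟩
  refine ⟨m u₀, fun u hu => ?_⟩
  have : m u₀ = m u := by
    rcases le_total u u₀ with hle | hle
    · exact hconst u hu u₀ hu₀ hle
    · exact (hconst u₀ hu₀ u hu hle).symm
  rw [this]
  exact hm u (hS0 hu)

theorem slope_nonpos (h : IsCritical X f a w) {β u : ℝ} (hu : 0 ≤ u)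
    (hβ : ∀ x, 0 ≤ x → f u + β * (x - u) ≤ f x) : β ≤ 0 := by
  have h1 := hβ (u + 1) (by linarith)
  have h2 := antitoneOn_of_mem_convexIntegrableCone h.mem hu (show u + 1 ∈ Ici 0 by simp; linarith)
    (show u ≤ u + 1 by linarith)
  linarith

/-- On (s, ∞) the function is affine; nonnegativity rules out a negative slope, and integrability a
positive constant. -/
theorem eq_zero_of_scorePrimitive_pos (h : IsCritical X f a w) {s : ℝ} (hs : 0 ≤ s)
    (hpos : ∀ u, s < u → 0 < scorePrimitive X a w u) {x : ℝ} (hx : s < x) : f x = 0 := by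
  obtain ⟨β, hβ⟩ := h.exists_slope (S := Ioi s) ordConnected_Ioi (Ioi_subset_Ioi hs) hpos
  have hx0 : 0 ≤ x := hs.trans hx.le
  have haff : ∀ y, s < y → f y = f x + β * (y - x) := by
    intro y hy
    have h1 := hβ x hx y (hs.trans hy.le)
    have h2 := hβ y hy x hx0
    linarith
  have hβ0 := h.slope_nonpos hx0 (hβ x hx)
  have hfx := nonneg_of_mem_convexIntegrableCone h.mem hx0
  have hβ1 : β = 0 := by
    by_contra hne
    have hneg : 0 < -β := by
      rcases lt_or_eq_of_le hβ0 with h | h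
      · linarith
      · exact absurd h hne
    -- At distance (f x + 1)/(-β) to the right of x the line takes the value -1.
    have hd : 0 ≤ (f x + 1) / (-β) := by positivity
    have h1 := haff (x + (f x + 1) / (-β)) (by linarith)
    have h2 := nonneg_of_mem_convexIntegrableCone h.mem (x := x + (f x + 1) / (-β)) (by linarith)
    have h3 : -β * ((f x + 1) / (-β)) = f x + 1 := by field_simp
    rw [h1] at h2
    linarith
  by_contra hne
  have hpos' : 0 < f x := lt_of_le_of_ne hfx (Ne.symm hne)
  refine not_integrableOn_Ici_of_le_abs hpos' (fun y hy => ?_)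
    (h.mem.2.mono_set (Ici_subset_Ici.2 hx0))
  rw [haff y (lt_of_lt_of_le hx hy), hβ1]
  simp [le_abs_self]

theorem isCompact_Icc_inter_zero (h : IsCritical X f a w) {x y : ℝ} (hx : 0 ≤ x) :
    IsCompact (Icc x y ∩ scorePrimitive X a w ⁻¹' {0}) := by
  refine isCompact_Icc.of_isClosed_subset ?_ inter_subset_left
  exact ((h.continuousOn_scorePrimitive y).mono (Icc_subset_Icc hx le_rfl)).preimage_isClosed_of_isClosed
    isClosed_Icc isClosed_singleton

/-- s is the last zero before x; zeros exist because H(0) = 0. -/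
theorem exists_left_zero (h : IsCritical X f a w) {x : ℝ} (hx : 0 ≤ x)
    (hpos : 0 < scorePrimitive X a w x) : ∃ s, 0 ≤ s ∧ s < x ∧ scorePrimitive X a w s = 0 ∧
      ∀ u, s < u → u ≤ x → 0 < scorePrimitive X a w u := by
  obtain ⟨s, ⟨hs, hs0⟩, hmax⟩ := (h.isCompact_Icc_inter_zero (y := x) le_rfl).exists_isGreatest
    ⟨0, ⟨le_rfl, hx⟩, by simp [scorePrimitive]⟩
  refine ⟨s, hs.1, lt_of_le_of_ne hs.2 ?_, hs0, fun u hu hux => ?_⟩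
  · rintro rfl
    exact hpos.ne' hs0
  · have hu0 : 0 ≤ u := hs.1.trans hu.le
    refine lt_of_le_of_ne (h.scorePrimitive_nonneg hu0) fun he => ?_
    exact absurd (hmax ⟨⟨hu0, hux⟩, he.symm⟩) hu.not_ge

theorem exists_right_zero (h : IsCritical X f a w) {x : ℝ} (hx : 0 ≤ x)
    (hpos : 0 < scorePrimitive X a w x) :
    (∀ u, x ≤ u → 0 < scorePrimitive X a w u) ∨ ∃ t, x < t ∧ scorePrimitive X a w t = 0 ∧
      ∀ u, x ≤ u → u < t → 0 < scorePrimitive X a w u := by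
  by_cases hex : ∃ z, x ≤ z ∧ scorePrimitive X a w z = 0
  · right
    obtain ⟨z, hxz, hz⟩ := hex
    obtain ⟨t, ⟨ht, ht0⟩, hmin⟩ := (h.isCompact_Icc_inter_zero (y := z) hx).exists_isLeast
      ⟨z, ⟨hxz, le_rfl⟩, hz⟩
    refine ⟨t, lt_of_le_of_ne ht.1 ?_, ht0, fun u hxu hut => ?_⟩
    · rintro rfl
      exact hpos.ne' ht0
    · refine lt_of_le_of_ne (h.scorePrimitive_nonneg (hx.trans hxu)) fun he => ?_
      exact absurd (hmin ⟨⟨hxu, hut.le.trans ht.2⟩, he.symm⟩) hut.not_ge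
  · left
    push Not at hex
    exact fun u hu => lt_of_le_of_ne (h.scorePrimitive_nonneg (hx.trans hu)) (hex u hu).symm

/-- Every point is a zero of the score primitive, or lies in a bounded or unbounded component of
the set where it is positive. -/
theorem zero_or_component (h : IsCritical X f a w) {x : ℝ} (hx : 0 ≤ x) :
    scorePrimitive X a w x = 0 ∨
    (∃ s t, 0 ≤ s ∧ s < x ∧ x < t ∧ scorePrimitive X a w s = 0 ∧ scorePrimitive X a w t = 0 ∧
      ∀ u ∈ Ioo s t, 0 < scorePrimitive X a w u) ∨
    (∃ s, 0 ≤ s ∧ s < x ∧ scorePrimitive X a w s = 0 ∧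
      ∀ u, s < u → 0 < scorePrimitive X a w u) := by
  rcases eq_or_lt_of_le (h.scorePrimitive_nonneg hx) with he | hpos
  · exact Or.inl he.symm
  right
  obtain ⟨s, hs, hsx, hs0, hsu⟩ := h.exists_left_zero hx hpos
  rcases h.exists_right_zero hx hpos with hu | ⟨t, hxt, ht0, htu⟩
  · right
    refine ⟨s, hs, hsx, hs0, fun u hu' => ?_⟩
    rcases le_total u x with hux | hux
    · exact hsu u hu' hux
    · exact hu u hux
  · left
    refine ⟨s, t, hs, hsx, hxt, hs0, ht0, fun u hu' => ?_⟩
    rcases le_total u x with hux | hux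
    · exact hsu u hu'.1 hux
    · exact htu u hux hu'.2

end IsCritical

/-! ### Comparison of distribution functions on components -/

section DistributionFunction

variable {f g : ℝ → ℝ}

theorem intervalIntegrable_of_mem_convexIntegrableCone (hf : f ∈ convexIntegrableCone)
    (x : ℝ) (hx : 0 ≤ x) : IntervalIntegrable f volume 0 x :=
  (intervalIntegrable_iff_integrableOn_Icc_of_le hx).2 (hf.2.mono_set Icc_subset_Ici_self)

theorem continuousOn_Ioi_of_mem_convexIntegrableCone (hf : f ∈ convexIntegrableCone) :
    ContinuousOn f (Ioi 0) :=
  fun _ hx => (hf.1.continuousAt_of_pos hx).continuousWithinAt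

theorem hasDerivAt_densityCDF_of_mem (hf : f ∈ convexIntegrableCone) {x : ℝ} (hx : 0 < x) :
    HasDerivAt (densityCDF f) (f x) x :=
  hasDerivAt_densityCDF (intervalIntegrable_of_mem_convexIntegrableCone hf)
    (continuousOn_Ioi_of_mem_convexIntegrableCone hf) hx

theorem continuousOn_densityCDF_of_mem (hf : f ∈ convexIntegrableCone) {s t : ℝ} (hs : 0 ≤ s) :
    ContinuousOn (densityCDF f) (Icc s t) :=
  (continuousOn_densityCDF (intervalIntegrable_of_mem_convexIntegrableCone hf) t).mono
    (Icc_subset_Icc hs le_rfl)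

theorem intervalIntegrable_densityCDF (hf : f ∈ convexIntegrableCone) {s t : ℝ} (hs : 0 ≤ s)
    (hst : s ≤ t) : IntervalIntegrable (densityCDF f) volume s t := by
  apply ContinuousOn.intervalIntegrable
  rw [uIcc_of_le hst]
  exact continuousOn_densityCDF_of_mem hf hs

theorem empiricalCDF_monotone {n : ℕ} (X : Fin n → ℝ) : Monotone (empiricalCDF X) := by
  have : empiricalCDF X = weightedCDF X (fun _ => 1) := funext empiricalCDF_eq_weightedCDF
  rw [this]
  exact weightedCDF_monotone fun _ => zero_le_one

theorem concaveOn_sub_of_affine (hf : ConvexOn ℝ (Ici 0) f) {s t β : ℝ} (hs : 0 ≤ s)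
    (hβ : ∀ u ∈ Ioo s t, ∀ x, 0 ≤ x → g u + β * (x - u) ≤ g x) :
    ConcaveOn ℝ (Ioo s t) (fun x => g x - f x) := by
  have hpos : ∀ u ∈ Ioo s t, 0 ≤ u := fun u hu => hs.trans hu.1.le
  have haff : ∀ u ∈ Ioo s t, ∀ v ∈ Ioo s t, g v = g u + β * (v - u) := by
    intro u hu v hv
    linarith [hβ u hu v (hpos v hv), hβ v hv u (hpos u hu)]
  refine ⟨convex_Ioo s t, fun x hx y hy p q hp hq hpq => ?_⟩
  have hmem : p • x + q • y ∈ Ioo s t := convex_Ioo s t hx hy hp hq hpq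
  have h1 := hf.2 (hpos x hx) (hpos y hy) hp hq hpq
  have h2 := haff _ hmem x hx
  have h3 := haff _ hmem y hy
  simp only [smul_eq_mul] at h1 h2 h3 ⊢
  rw [h2, h3]
  have hq' : q = 1 - p := by linarith
  subst hq'
  nlinarith

end DistributionFunction

namespace IsCritical

variable {n : ℕ} {X : Fin n → ℝ} {f g a w : ℝ → ℝ} {A B : ℝ}

/-- The argument common to both estimators: `hzero`, `hbdd` and `hunbdd` isolate what has to be
checked for each of them. -/
theorem lower_bound (h : IsCritical X g a w) (hf : f ∈ convexIntegrableCone)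
    (hzero : ∀ s, 0 ≤ s → scorePrimitive X a w s = 0 → densityCDF g s = empiricalCDF X s)
    (hbdd : ∀ s t, 0 ≤ s → s < t → scorePrimitive X a w s = 0 → scorePrimitive X a w t = 0 →
      (∀ u ∈ Ioo s t, 0 < scorePrimitive X a w u) →
      ∀ x ∈ Icc s t, 0 ≤ ∫ u in s..x, (densityCDF g u - empiricalCDF X u))
    (hunbdd : ∀ s, 0 ≤ s → scorePrimitive X a w s = 0 →
      (∀ u, s < u → 0 < scorePrimitive X a w u) → ∀ x, s < x → densityCDF g x = empiricalCDF X x)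
    (hA : ∀ x, 0 ≤ x → A ≤ empiricalCDF X x - densityCDF f x)
    (hB : ∀ x, 0 ≤ x → empiricalCDF X x - densityCDF f x ≤ B) {x : ℝ} (hx : 0 ≤ x) :
    3 / 2 * A - 1 / 2 * B ≤ densityCDF g x - densityCDF f x := by
  have hAx := hA x hx
  have hBx := hB x hx
  rcases h.zero_or_component hx with h0 | ⟨s, t, hs, hsx, hxt, hs0, ht0, hpos⟩ |
    ⟨s, hs, hsx, hs0, hpos⟩
  · rw [hzero x hx h0]; linarith
  · obtain ⟨β, hβ⟩ := h.exists_slope (S := Ioo s t) ordConnected_Ioo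
      (fun u hu => hs.trans_lt hu.1) hpos
    have ht : 0 ≤ t := by linarith
    refine lower_bound_of_concaveOn_deriv (D := fun x => densityCDF g x - densityCDF f x)
      (s := s) (t := t) ((continuousOn_densityCDF_of_mem h.mem hs).sub
      (continuousOn_densityCDF_of_mem hf hs))
      (fun u hu => (hasDerivAt_densityCDF_of_mem h.mem (hs.trans_lt hu.1)).sub
        (hasDerivAt_densityCDF_of_mem hf (hs.trans_lt hu.1)))
      (concaveOn_sub_of_affine hf.1 hs hβ) ?_ ?_ ?_ ?_ ⟨hsx.le, hxt.le⟩
    · rw [hzero s hs hs0]; exact hA s hs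
    · rw [hzero s hs hs0]; exact hB s hs
    · rw [hzero t ht ht0]; exact hA t ht
    · intro y hy
      have hg := intervalIntegrable_densityCDF h.mem hs hy.1
      have hf' := intervalIntegrable_densityCDF hf hs hy.1
      have he := (empiricalCDF_monotone X).intervalIntegrable (μ := volume) (a := s) (b := y)
      have h1 := hbdd s t hs (hsx.trans hxt) hs0 ht0 hpos y hy
      -- D is the sum of F̂ - 𝔽, with nonnegative integral, and 𝔽 - F ≥ A.
      have h2 : ∫ u in s..y, A ≤ ∫ u in s..y, (empiricalCDF X u - densityCDF f u) :=
        intervalIntegral.integral_mono_on hy.1 intervalIntegrable_const (he.sub hf')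
          fun u hu => hA u (hs.trans hu.1)
      rw [intervalIntegral.integral_const, smul_eq_mul] at h2
      rw [intervalIntegral.integral_sub hg he] at h1
      rw [intervalIntegral.integral_sub he hf'] at h2
      rw [intervalIntegral.integral_sub hg hf']
      linarith
  · rw [hunbdd s hs hs0 hpos x hsx]; linarith

theorem upper_bound (h : IsCritical X g a w) (hf : f ∈ convexIntegrableCone)
    (hzero : ∀ s, 0 ≤ s → scorePrimitive X a w s = 0 → densityCDF g s = empiricalCDF X s)
    (hbdd : ∀ s t, 0 ≤ s → s < t → scorePrimitive X a w s = 0 → scorePrimitive X a w t = 0 →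
      (∀ u ∈ Ioo s t, 0 < scorePrimitive X a w u) →
      ∀ x ∈ Icc s t, ∫ u in x..t, (densityCDF g u - empiricalCDF X u) ≤ 0)
    (hunbdd : ∀ s, 0 ≤ s → scorePrimitive X a w s = 0 →
      (∀ u, s < u → 0 < scorePrimitive X a w u) → ∀ x, s < x → densityCDF g x = empiricalCDF X x)
    (hA : ∀ x, 0 ≤ x → A ≤ empiricalCDF X x - densityCDF f x)
    (hB : ∀ x, 0 ≤ x → empiricalCDF X x - densityCDF f x ≤ B) {x : ℝ} (hx : 0 ≤ x) :
    densityCDF g x - densityCDF f x ≤ 3 / 2 * B - 1 / 2 * A := by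
  have hAx := hA x hx
  have hBx := hB x hx
  rcases h.zero_or_component hx with h0 | ⟨s, t, hs, hsx, hxt, hs0, ht0, hpos⟩ |
    ⟨s, hs, hsx, hs0, hpos⟩
  · rw [hzero x hx h0]; linarith
  · obtain ⟨β, hβ⟩ := h.exists_slope (S := Ioo s t) ordConnected_Ioo
      (fun u hu => hs.trans_lt hu.1) hpos
    have ht : 0 ≤ t := by linarith
    refine upper_bound_of_concaveOn_deriv (D := fun x => densityCDF g x - densityCDF f x)
      (s := s) (t := t) ((continuousOn_densityCDF_of_mem h.mem hs).sub
      (continuousOn_densityCDF_of_mem hf hs))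
      (fun u hu => (hasDerivAt_densityCDF_of_mem h.mem (hs.trans_lt hu.1)).sub
        (hasDerivAt_densityCDF_of_mem hf (hs.trans_lt hu.1)))
      (concaveOn_sub_of_affine hf.1 hs hβ) ?_ ?_ ?_ ?_ ⟨hsx.le, hxt.le⟩
    · rw [hzero s hs hs0]; exact hB s hs
    · rw [hzero t ht ht0]; exact hA t ht
    · rw [hzero t ht ht0]; exact hB t ht
    · intro y hy
      have hy0 : 0 ≤ y := hs.trans hy.1
      have hg := intervalIntegrable_densityCDF h.mem hy0 hy.2
      have hf' := intervalIntegrable_densityCDF hf hy0 hy.2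
      have he := (empiricalCDF_monotone X).intervalIntegrable (μ := volume) (a := y) (b := t)
      have h1 := hbdd s t hs (hsx.trans hxt) hs0 ht0 hpos y hy
      have h2 : ∫ u in y..t, (empiricalCDF X u - densityCDF f u) ≤ ∫ u in y..t, B :=
        intervalIntegral.integral_mono_on hy.2 (he.sub hf') intervalIntegrable_const
          fun u hu => hB u (hy0.trans hu.1)
      rw [intervalIntegral.integral_const, smul_eq_mul] at h2
      rw [intervalIntegral.integral_sub hg he] at h1
      rw [intervalIntegral.integral_sub he hf'] at h2
      rw [intervalIntegral.integral_sub hg hf']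
      linarith
  · rw [hunbdd s hs hs0 hpos x hsx]; linarith

end IsCritical

/-! ### The estimators satisfy the first order conditions -/

theorem integrableOn_mul_of_mem_convexIntegrableCone {f φ : ℝ → ℝ} (hf : f ∈ convexIntegrableCone)
    (hφ : IntegrableOn φ (Ici 0)) : IntegrableOn (fun x => f x * φ x) (Ici 0) := by
  refine Integrable.bdd_mul (c := f 0) hφ hf.2.aestronglyMeasurable ?_
  filter_upwards [ae_restrict_mem measurableSet_Ici] with x hx
  rw [Real.norm_of_nonneg (nonneg_of_mem_convexIntegrableCone hf hx)]
  exact antitoneOn_of_mem_convexIntegrableCone hf (show (0 : ℝ) ∈ Ici 0 by simp) hx hx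

theorem nonneg_of_forall_add_mul_nonneg {L Q : ℝ} (h : ∀ τ, 0 < τ → τ ≤ 1 → 0 ≤ L + τ * Q) :
    0 ≤ L := by
  by_contra! hL
  have h1 : 0 < -L / (|Q| + 1) := div_pos (by linarith) (by positivity)
  have h2 := h (min 1 (-L / (|Q| + 1))) (lt_min one_pos h1) (min_le_left _ _)
  have h3 : min 1 (-L / (|Q| + 1)) * Q ≤ min 1 (-L / (|Q| + 1)) * |Q| :=
    mul_le_mul_of_nonneg_left (le_abs_self Q) (lt_min one_pos h1).le
  have h4 : min 1 (-L / (|Q| + 1)) * (|Q| + 1) ≤ -L :=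
    (le_div_iff₀ (by positivity)).1 (min_le_right _ _)
  have h5 : 0 < min 1 (-L / (|Q| + 1)) := lt_min one_pos h1
  linarith

section Estimators

variable {n : ℕ} {X : Fin n → ℝ} {f : ℝ → ℝ}

theorem lsCriterion_add_mul {d : ℝ → ℝ} (hf : f ∈ convexIntegrableCone)
    (hd : IntegrableOn d (Ici 0)) (hd2 : IntegrableOn (fun x => d x ^ 2) (Ici 0)) (τ : ℝ) :
    lsCriterion X (fun x => f x + τ * d x) = lsCriterion X f
      + 2 * τ * scoreFunctional X f (fun _ => 1) d + τ ^ 2 * ∫ x in Ici (0 : ℝ), d x ^ 2 := by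
  have h1 : IntegrableOn (fun x => f x ^ 2) (Ici 0) := by
    simpa [sq] using integrableOn_mul_of_mem_convexIntegrableCone hf hf.2
  have h2 := integrableOn_mul_of_mem_convexIntegrableCone hf hd
  have h3 : ∫ x in Ici (0 : ℝ), (f x + τ * d x) ^ 2 = (∫ x in Ici (0 : ℝ), f x ^ 2)
      + 2 * τ * (∫ x in Ici (0 : ℝ), f x * d x) + τ ^ 2 * ∫ x in Ici (0 : ℝ), d x ^ 2 := by
    have h12 : IntegrableOn (fun x => f x ^ 2 + 2 * τ * (f x * d x)) (Ici 0) :=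
      h1.add (h2.const_mul _)
    rw [← integral_const_mul, ← integral_const_mul, ← integral_add h1 (h2.const_mul _),
      ← integral_add h12 (hd2.const_mul _)]
    congr 1; ext x; ring
  unfold lsCriterion scoreFunctional
  rw [h3, empiricalIntegral_add X f, empiricalIntegral_const_mul]
  simp only [one_mul]
  ring

theorem IsConvexLSE.isCritical (hX : ∀ i, 0 ≤ X i) (h : IsConvexLSE X f) :
    IsCritical X f f (fun _ => 1) where
  sample_nonneg := hX
  mem := h.1
  nonneg := fun _ hx => nonneg_of_mem_convexIntegrableCone h.1 hx
  continuousOn := continuousOn_Ioi_of_mem_convexIntegrableCone h.1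
  integrable_mul := fun _ hφ => integrableOn_mul_of_mem_convexIntegrableCone h.1 hφ
  weight_pos := fun _ => one_pos
  score_nonneg := by
    intro g hg
    have hd : IntegrableOn (fun x => g x - f x) (Ici 0) := hg.2.sub h.1.2
    have hd2 : IntegrableOn (fun x => (g x - f x) ^ 2) (Ici 0) := by
      refine ((integrableOn_mul_of_mem_convexIntegrableCone hg hd).sub
        (integrableOn_mul_of_mem_convexIntegrableCone h.1 hd)).congr_fun ?_ measurableSet_Ici
      intro x _
      simp only [Pi.sub_apply]
      ring
    refine nonneg_of_forall_add_mul_nonneg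
      (Q := (∫ x in Ici (0 : ℝ), (g x - f x) ^ 2) / 2) fun τ h0 h1 => ?_
    have hmem : (fun x => f x + τ * (g x - f x)) ∈ convexIntegrableCone :=
      add_smul_mem_convexIntegrableCone (d := fun x => g x - f x) h.1
        (by convert hg using 1; ext x; simp) h0.le h1
    have hmin : lsCriterion X f ≤ lsCriterion X (fun x => f x + τ * (g x - f x)) := h.2 hmem
    rw [lsCriterion_add_mul h.1 hd hd2] at hmin
    have : 0 ≤ (2 * τ) * (scoreFunctional X f (fun _ => 1) (fun x => g x - f x)
        + τ * ((∫ x in Ici (0 : ℝ), (g x - f x) ^ 2) / 2)) := by linarith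
    exact nonneg_of_mul_nonneg_right this (by linarith)

theorem IsConvexMLE.pos (h : IsConvexMLE X f) (i : Fin n) : 0 < f (X i) := by
  classical
  -- Otherwise the criterion is -∞ at f, while a function (C - x)₊ that is positive at all
  -- observations has a finite criterion.
  by_contra hi
  have hbot : mlCriterion X f = ⊥ := if_neg fun hall => hi (hall i)
  set C := 1 + ∑ j, |X j| with hC
  have hpos : ∀ j, 0 < max (C - X j) 0 := by
    intro j
    have h1 : |X j| ≤ ∑ k, |X k| :=
      Finset.single_le_sum (f := fun k => |X k|) (fun k _ => abs_nonneg _) (Finset.mem_univ j)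
    have h2 := le_abs_self (X j)
    exact lt_max_of_lt_left (by linarith)
  have h1 : mlCriterion X (fun x => max (C - x) 0) ≤ mlCriterion X f :=
    h.2 (max_sub_zero_mem_convexIntegrableCone C)
  rw [hbot, le_bot_iff, mlCriterion, if_pos hpos] at h1
  exact EReal.coe_ne_bot _ h1

theorem IsConvexMLE.isCritical (hX : ∀ i, 0 ≤ X i) (h : IsConvexMLE X f) :
    IsCritical X f (fun _ => 1) (fun x => (f x)⁻¹) where
  sample_nonneg := hX
  mem := h.1
  nonneg := fun _ _ => zero_le_one
  continuousOn := continuousOn_const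
  integrable_mul := fun φ hφ => by simpa using hφ
  weight_pos := fun i => inv_pos.2 (h.pos i)
  score_nonneg := by
    intro g hg
    set d : ℝ → ℝ := fun x => g x - f x with hd_def
    have hd : IntegrableOn d (Ici 0) := hg.2.sub h.1.2
    -- ψ is the criterion along the segment from f to g; it is maximal at τ = 0, where its
    -- derivative is minus the score of g - f.
    set ψ : ℝ → ℝ := fun τ => (∑ i, Real.log (f (X i) + τ * d (X i))) / n
      - ((∫ x in Ici (0 : ℝ), f x) + τ * ∫ x in Ici (0 : ℝ), d x) with hψ
    have hderiv : HasDerivAt ψ (-scoreFunctional X (fun _ => 1) (fun x => (f x)⁻¹) d) 0 := by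
      have h1 : ∀ i, HasDerivAt (fun τ => Real.log (f (X i) + τ * d (X i)))
          ((f (X i))⁻¹ * d (X i)) 0 := by
        intro i
        have h2 : HasDerivAt (fun τ => f (X i) + τ * d (X i)) (1 * d (X i)) 0 :=
          ((hasDerivAt_id (0 : ℝ)).mul_const (d (X i))).const_add (f (X i))
        have h3 := h2.log (by simpa using (h.pos i).ne')
        refine h3.congr_deriv ?_
        simp [div_eq_mul_inv, mul_comm]
      have h4 := (HasDerivAt.fun_sum (u := Finset.univ) fun i _ => h1 i).div_const (n : ℝ)
      have h5 : HasDerivAt (fun τ : ℝ => (∫ x in Ici (0 : ℝ), f x) + τ * ∫ x in Ici (0 : ℝ), d x)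
          (1 * ∫ x in Ici (0 : ℝ), d x) 0 :=
        ((hasDerivAt_id (0 : ℝ)).mul_const _).const_add _
      refine (h4.sub h5).congr_deriv ?_
      simp [scoreFunctional, empiricalIntegral]
    have hle : ∀ τ ∈ Ioo (0 : ℝ) 1, ψ τ ≤ ψ 0 := by
      intro τ hτ
      have hmem : (fun x => f x + τ * d x) ∈ convexIntegrableCone :=
        add_smul_mem_convexIntegrableCone h.1
          (by convert hg using 1; ext x; simp [hd_def]) hτ.1.le hτ.2.le
      have hpos : ∀ i, 0 < f (X i) + τ * d (X i) := by
        intro i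
        have h1 := nonneg_of_mem_convexIntegrableCone hg (hX i)
        have h2 : f (X i) + τ * d (X i) = (1 - τ) * f (X i) + τ * g (X i) := by
          simp only [hd_def]; ring
        rw [h2]
        exact add_pos_of_pos_of_nonneg (mul_pos (by linarith [hτ.2]) (h.pos i))
          (mul_nonneg hτ.1.le h1)
      have hmax : mlCriterion X (fun x => f x + τ * d x) ≤ mlCriterion X f := h.2 hmem
      rw [mlCriterion, mlCriterion, if_pos hpos, if_pos h.pos, EReal.coe_le_coe_iff,
        integral_add h.1.2 (hd.const_mul τ), integral_const_mul] at hmax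
      simpa [hψ, empiricalIntegral] using hmax
    have h1 := hderiv.hasDerivWithinAt (s := Ioi 0)
    rw [hasDerivWithinAt_iff_tendsto_slope' (by simp)] at h1
    have h2 := le_of_tendsto (b := 0) h1 (by
      filter_upwards [Ioo_mem_nhdsGT one_pos] with τ hτ
      rw [slope_def_field]
      exact div_nonpos_of_nonpos_of_nonneg (by linarith [hle τ hτ]) (by linarith [hτ.1]))
    linarith

/-! ### Estimated versus empirical distribution function -/

theorem scoreCDF_one (x : ℝ) :
    scoreCDF X f (fun _ => 1) x = densityCDF f x - empiricalCDF X x := by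
  rw [scoreCDF, empiricalCDF_eq_weightedCDF]

theorem IsConvexLSE.integral_sub (hX : ∀ i, 0 ≤ X i) (h : IsConvexLSE X f) {s t : ℝ} (hs : 0 ≤ s)
    (ht : 0 ≤ t) : ∫ u in s..t, (densityCDF f u - empiricalCDF X u)
      = scorePrimitive X f (fun _ => 1) t - scorePrimitive X f (fun _ => 1) s := by
  have hc := h.isCritical hX
  simp only [← scoreCDF_one]
  exact (intervalIntegral.integral_interval_sub_left (hc.intervalIntegrable_scoreCDF le_rfl ht)
    (hc.intervalIntegrable_scoreCDF le_rfl hs)).symm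

theorem IsConvexLSE.densityCDF_eq (hX : ∀ i, 0 ≤ X i) (h : IsConvexLSE X f) {s : ℝ} (hs : 0 ≤ s)
    (hs0 : scorePrimitive X f (fun _ => 1) s = 0) : densityCDF f s = empiricalCDF X s := by
  have := (h.isCritical hX).scoreCDF_eq_zero hs hs0
  rw [scoreCDF_one] at this
  linarith

/-- Otherwise f vanishes beyond s, so F̂ stays at F̂(s) = 𝔽(s) ≤ 𝔽 there, and H could not rise above
H(s) = 0. -/
theorem IsConvexLSE.not_forall_scorePrimitive_pos (hX : ∀ i, 0 ≤ X i) (h : IsConvexLSE X f) {s : ℝ}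
    (hs : 0 ≤ s) (hs0 : scorePrimitive X f (fun _ => 1) s = 0) :
    ¬ ∀ u, s < u → 0 < scorePrimitive X f (fun _ => 1) u := by
  intro hpos
  have hc := h.isCritical hX
  have h1 := h.integral_sub hX hs (show 0 ≤ s + 1 by linarith)
  have hint := intervalIntegrable_of_mem_convexIntegrableCone h.1
  have h2 : ∫ u in s..(s + 1), (densityCDF f u - empiricalCDF X u) ≤ ∫ u in s..(s + 1), (0 : ℝ) := by
    refine intervalIntegral.integral_mono_on (by linarith)
      ((intervalIntegrable_densityCDF h.1 hs (by linarith)).sub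
        (empiricalCDF_monotone X).intervalIntegrable) intervalIntegrable_const fun u hu => ?_
    have h3 : ∫ v in s..u, f v = 0 := by
      rw [intervalIntegral.integral_of_le hu.1]
      refine setIntegral_eq_zero_of_forall_eq_zero fun v hv => ?_
      exact hc.eq_zero_of_scorePrimitive_pos hs hpos hv.1
    have h4 := intervalIntegral.integral_interval_sub_left (hint u (hs.trans hu.1)) (hint s hs)
    have h5 := empiricalCDF_monotone X hu.1
    have h6 := h.densityCDF_eq hX hs hs0
    unfold densityCDF at h6 ⊢
    linarith
  simp only [intervalIntegral.integral_zero] at h2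
  linarith [hpos (s + 1) (by linarith)]

/-- This is L(`leftPart`) = 0 expanded. The weight 1/f cancels f at the observations, so the term
with f gives F̂ - 𝔽; the constant and linear terms give G and H. -/
theorem IsConvexMLE.densityCDF_sub_empiricalCDF (hX : ∀ i, 0 ≤ X i) (h : IsConvexMLE X f)
    {m z : ℝ} (hz : 0 < z) (hm : ∀ x, 0 ≤ x → f z + m * (x - z) ≤ f x) :
    densityCDF f z - empiricalCDF X z = f z * scoreCDF X (fun _ => 1) (fun x => (f x)⁻¹) z
      - m * scorePrimitive X (fun _ => 1) (fun x => (f x)⁻¹) z := by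
  have hc := h.isCritical hX
  have h0 := hc.scoreFunctional_leftPart hz hm
  have hdec : leftPart f m z = fun x => (Iic z).indicator f x
      + ((-f z) * (Iic z).indicator 1 x + m * max (z - x) 0) := by
    ext x
    rcases le_or_gt x z with hx | hx
    · simp [leftPart, hx]; ring
    · simp [leftPart, hx, hx.le]
  have hint1 : IntegrableOn ((Iic z).indicator f) (Ici 0) :=
    integrableOn_indicator_Iic (h.1.2.mono_set Icc_subset_Ici_self)
  have hint2 : IntegrableOn (fun x => (-f z) * (Iic z).indicator 1 x) (Ici 0) :=
    (integrableOn_indicator_Iic continuous_one.integrableOn_Icc).const_mul _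
  have hint3 : IntegrableOn (fun x => m * max (z - x) 0) (Ici 0) :=
    (integrableOn_max_sub_zero z).const_mul m
  have hint23 : IntegrableOn (fun x => (-f z) * (Iic z).indicator 1 x + m * max (z - x) 0) (Ici 0) :=
    hint2.add hint3
  rw [hdec, hc.scoreFunctional_add hint1 hint23, hc.scoreFunctional_add hint2 hint3,
    scoreFunctional_const_mul, scoreFunctional_const_mul,
    IsCritical.scoreFunctional_indicator hz.le, hc.scoreFunctional_max_sub_zero hz.le] at h0
  have h1 : scoreFunctional X (fun _ => 1) (fun x => (f x)⁻¹) ((Iic z).indicator f)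
      = densityCDF f z - empiricalCDF X z := by
    unfold scoreFunctional densityCDF
    simp only [one_mul]
    rw [setIntegral_Ici_indicator_Iic hz.le, empiricalCDF_eq_empiricalIntegral]
    congr 1
    refine empiricalIntegral_congr fun i => ?_
    by_cases hi : X i ≤ z
    · simp [hi, (h.pos i).ne']
    · simp [hi]
  rw [h1] at h0
  linarith

theorem IsConvexMLE.densityCDF_eq (hX : ∀ i, 0 ≤ X i) (h : IsConvexMLE X f) {s : ℝ} (hs : 0 ≤ s)
    (hs0 : scorePrimitive X (fun _ => 1) (fun x => (f x)⁻¹) s = 0) :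
    densityCDF f s = empiricalCDF X s := by
  have hc := h.isCritical hX
  -- At s = 0 an interior subgradient is not available; there both sides vanish because no
  -- observation equals 0.
  rcases eq_or_lt_of_le hs with rfl | hs'
  · rw [hc.empiricalCDF_zero]; simp [densityCDF]
  · obtain ⟨m, hm⟩ := h.1.1.exists_subgradient hs'
    have h1 := h.densityCDF_sub_empiricalCDF hX hs' hm
    rw [hs0, hc.scoreCDF_eq_zero hs hs0] at h1
    linarith

/-- Integrating f G - β H by parts gives f(x) H(x) - 2β∫H, and β ≤ 0. -/
theorem IsConvexMLE.integral_sub_nonneg (hX : ∀ i, 0 ≤ X i) (h : IsConvexMLE X f) {s t : ℝ}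
    (hs : 0 ≤ s) (hs0 : scorePrimitive X (fun _ => 1) (fun x => (f x)⁻¹) s = 0)
    (ht0 : scorePrimitive X (fun _ => 1) (fun x => (f x)⁻¹) t = 0)
    (hpos : ∀ u ∈ Ioo s t, 0 < scorePrimitive X (fun _ => 1) (fun x => (f x)⁻¹) u)
    {x : ℝ} (hx : x ∈ Icc s t) : 0 ≤ ∫ u in s..x, (densityCDF f u - empiricalCDF X u) := by
  have hc := h.isCritical hX
  rcases eq_or_lt_of_le hx.1 with rfl | hsx
  · simp
  have hx0 : 0 ≤ x := hs.trans hx.1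
  set G := scoreCDF X (fun _ => 1) (fun x => (f x)⁻¹) with hG
  set H := scorePrimitive X (fun _ => 1) (fun x => (f x)⁻¹) with hH
  obtain ⟨β, hβ⟩ := hc.exists_slope (S := Ioo s t) ordConnected_Ioo
    (fun u hu => hs.trans_lt hu.1) hpos
  obtain ⟨c, hc1, hc2⟩ := exists_between (hsx.trans_le hx.2)
  have hcm : c ∈ Ioo s t := ⟨hc1, hc2⟩
  have hc0 : 0 ≤ c := hs.trans hc1.le
  have hβ0 := hc.slope_nonpos hc0 (hβ c hcm)
  have haff : ∀ u ∈ Ioo s t, f u = f c + β * (u - c) := fun u hu => by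
    have hu0 : 0 ≤ u := hs.trans hu.1.le
    linarith [hβ u hu c hc0, hβ c hcm u hu0]
  have hHcont : ContinuousOn H (Icc s x) :=
    (hc.continuousOn_scorePrimitive x).mono (Icc_subset_Icc hs le_rfl)
  have hHint : IntervalIntegrable H volume s x := by
    apply ContinuousOn.intervalIntegrable
    rwa [uIcc_of_le hx.1]
  have hGint : IntervalIntegrable G volume s x := hc.intervalIntegrable_scoreCDF hs hx0
  -- The affine formula replaces f because f may jump at s = 0.
  have hparts : ∫ u in s..x, (f c + β * (u - c)) * G u
      = (f c + β * (x - c)) * H x - (f c + β * (s - c)) * H s - ∫ u in s..x, β * H u := by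
    refine intervalIntegral.integral_mul_deriv_eq_deriv_mul_of_hasDeriv_right
      (u := fun u => f c + β * (u - c)) (u' := fun _ => β) (by fun_prop)
      (by rwa [uIcc_of_le hx.1]) (fun u _ => ?_) (fun u hu => ?_) intervalIntegrable_const hGint
    · have h1 := (((hasDerivAt_id u).sub_const c).const_mul β).const_add (f c)
      exact (h1.congr_deriv (by simp)).hasDerivWithinAt
    · rw [min_eq_left hx.1] at hu
      exact (hc.hasDerivWithinAt_scorePrimitive (hs.trans hu.1.le)).Ioi_of_Ici
  have hcongr : ∫ u in s..x, (densityCDF f u - empiricalCDF X u)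
      = ∫ u in s..x, ((f c + β * (u - c)) * G u - β * H u) := by
    rw [intervalIntegral.integral_of_le hx.1, intervalIntegral.integral_of_le hx.1,
      integral_Ioc_eq_integral_Ioo, integral_Ioc_eq_integral_Ioo]
    refine setIntegral_congr_fun measurableSet_Ioo fun u hu => ?_
    have hu' : u ∈ Ioo s t := ⟨hu.1, hu.2.trans_le hx.2⟩
    have h1 := h.densityCDF_sub_empiricalCDF hX (hs.trans_lt hu.1) (hβ u hu')
    simp only [← hG, ← hH] at h1
    rw [← haff u hu']
    exact h1
  have hHnonneg : 0 ≤ ∫ u in s..x, H u := intervalIntegral.integral_nonneg hx.1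
    fun u hu => hc.scorePrimitive_nonneg (hs.trans hu.1)
  have hend : 0 ≤ (f c + β * (x - c)) * H x := by
    rcases eq_or_lt_of_le hx.2 with rfl | hxt
    · simp [ht0]
    · rw [← haff x ⟨hsx, hxt⟩]
      exact mul_nonneg (nonneg_of_mem_convexIntegrableCone h.1 hx0) (hc.scorePrimitive_nonneg hx0)
  rw [hcongr, intervalIntegral.integral_sub (hGint.continuousOn_mul (by fun_prop))
    (hHint.const_mul β), hparts, hs0, intervalIntegral.integral_const_mul]
  nlinarith

/-- Since f(x) = 0 and f ≥ 0, the slope 0 is a subgradient at x, and the right side of the identity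
for F̂ - 𝔽 vanishes. -/
theorem IsConvexMLE.densityCDF_eq_of_forall_pos (hX : ∀ i, 0 ≤ X i) (h : IsConvexMLE X f) {s : ℝ}
    (hs : 0 ≤ s) (hpos : ∀ u, s < u → 0 < scorePrimitive X (fun _ => 1) (fun x => (f x)⁻¹) u)
    {x : ℝ} (hx : s < x) : densityCDF f x = empiricalCDF X x := by
  have hfx := (h.isCritical hX).eq_zero_of_scorePrimitive_pos hs hpos hx
  have h1 := h.densityCDF_sub_empiricalCDF hX (m := 0) (hs.trans_lt hx)
    (fun y hy => by simpa [hfx] using nonneg_of_mem_convexIntegrableCone h.1 hy)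
  rw [hfx] at h1
  linarith

end Estimators

/-! ### A priori bounds and conclusion -/

section Bounds

variable {f : ℝ → ℝ}

theorem IsConvexDensity.densityCDF_mem_Icc (hf : IsConvexDensity f) {x : ℝ} (hx : 0 ≤ x) :
    densityCDF f x ∈ Icc 0 1 := by
  refine ⟨intervalIntegral.integral_nonneg hx fun u hu => hf.nonneg u hu.1, ?_⟩
  rw [densityCDF, intervalIntegral.integral_of_le hx, ← hf.integral_eq_one]
  refine setIntegral_mono_set hf.integrableOn ?_ ?_
  · filter_upwards [ae_restrict_mem measurableSet_Ici] with u hu using hf.nonneg u hu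
  · exact ae_of_all _ fun u hu => le_of_lt hu.1

theorem empiricalCDF_mem_Icc {n : ℕ} (X : Fin n → ℝ) (x : ℝ) : empiricalCDF X x ∈ Icc 0 1 := by
  refine ⟨by unfold empiricalCDF; positivity, div_le_one_of_le₀ ?_ (Nat.cast_nonneg n)⟩
  have := Finset.card_filter_le (Finset.univ : Finset (Fin n)) (fun i => X i ≤ x)
  rw [Finset.card_univ, Fintype.card_fin] at this
  exact_mod_cast this

theorem abs_empiricalCDF_sub_densityCDF_le {n : ℕ} (X : Fin n → ℝ) (hf : IsConvexDensity f) {x : ℝ}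
    (hx : 0 ≤ x) : |empiricalCDF X x - densityCDF f x| ≤ 1 := by
  obtain ⟨h1, h2⟩ := empiricalCDF_mem_Icc X x
  obtain ⟨h3, h4⟩ := hf.densityCDF_mem_Icc hx
  rw [abs_le]
  constructor <;> linarith

end Bounds

theorem theorem1 (f : ℝ → ℝ) (hf : IsConvexDensity f)
    (n : ℕ) (hn : 0 < n) (X : Fin n → ℝ) (hX : ∀ i, 0 ≤ X i) :
    (∀ fml : ℝ → ℝ, IsConvexMLE X fml →
      (3 / 2 : ℝ) * (⨅ x : Set.Ici (0 : ℝ), (empiricalCDF X x - densityCDF f x))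
          - (1 / 2 : ℝ) * (⨆ x : Set.Ici (0 : ℝ), (empiricalCDF X x - densityCDF f x))
        ≤ ⨅ x : Set.Ici (0 : ℝ), (densityCDF fml x - densityCDF f x)) ∧
    (∀ fls : ℝ → ℝ, IsConvexLSE X fls →
      (⨆ x : Set.Ici (0 : ℝ), |densityCDF fls x - densityCDF f x|)
        ≤ 2 * ⨆ x : Set.Ici (0 : ℝ), |empiricalCDF X x - densityCDF f x|) := by
  have hne : Nonempty (Ici (0 : ℝ)) := ⟨⟨0, by simp⟩⟩
  have hfm := hf.mem_convexIntegrableCone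
  constructor
  · intro g hg
    have hlow : BddBelow (range fun x : Ici (0 : ℝ) => empiricalCDF X x - densityCDF f x) :=
      ⟨-1, by
        rintro _ ⟨x, rfl⟩
        exact (abs_le.1 (abs_empiricalCDF_sub_densityCDF_le X hf x.2)).1⟩
    have hup : BddAbove (range fun x : Ici (0 : ℝ) => empiricalCDF X x - densityCDF f x) :=
      ⟨1, by
        rintro _ ⟨x, rfl⟩
        exact (abs_le.1 (abs_empiricalCDF_sub_densityCDF_le X hf x.2)).2⟩
    refine le_ciInf fun x => ?_
    exact (hg.isCritical hX).lower_bound hfm (fun s hs hs0 => hg.densityCDF_eq hX hs hs0)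
      (fun s t hs _ hs0 ht0 hpos y hy => hg.integral_sub_nonneg hX hs hs0 ht0 hpos hy)
      (fun s hs _ hpos y hy => hg.densityCDF_eq_of_forall_pos hX hs hpos hy)
      (fun y hy => ciInf_le hlow ⟨y, hy⟩) (fun y hy => le_ciSup hup ⟨y, hy⟩) x.2
  · intro g hg
    have hup : BddAbove (range fun x : Ici (0 : ℝ) => |empiricalCDF X x - densityCDF f x|) :=
      ⟨1, by
        rintro _ ⟨x, rfl⟩
        exact abs_empiricalCDF_sub_densityCDF_le X hf x.2⟩
    set ε := ⨆ x : Ici (0 : ℝ), |empiricalCDF X x - densityCDF f x| with hε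
    have hle : ∀ y, 0 ≤ y → |empiricalCDF X y - densityCDF f y| ≤ ε :=
      fun y hy => le_ciSup hup ⟨y, hy⟩
    have hc := hg.isCritical hX
    refine ciSup_le fun x => ?_
    have h1 := hc.lower_bound hfm (fun s hs hs0 => hg.densityCDF_eq hX hs hs0)
      (fun s t hs _ hs0 ht0 hpos y hy => by
        rw [hg.integral_sub hX hs (hs.trans hy.1), hs0, sub_zero]
        exact hc.scorePrimitive_nonneg (hs.trans hy.1))
      (fun s hs hs0 hpos => absurd hpos (hg.not_forall_scorePrimitive_pos hX hs hs0))
      (fun y hy => (abs_le.1 (hle y hy)).1) (fun y hy => (abs_le.1 (hle y hy)).2) x.2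
    have h2 := hc.upper_bound hfm (fun s hs hs0 => hg.densityCDF_eq hX hs hs0)
      (fun s t hs hst hs0 ht0 hpos y hy => by
        rw [hg.integral_sub hX (hs.trans hy.1) (hs.trans hst.le), ht0, zero_sub]
        exact neg_nonpos.2 (hc.scorePrimitive_nonneg (hs.trans hy.1)))
      (fun s hs hs0 hpos => absurd hpos (hg.not_forall_scorePrimitive_pos hX hs hs0))
      (fun y hy => (abs_le.1 (hle y hy)).1) (fun y hy => (abs_le.1 (hle y hy)).2) x.2
    -- With A = -ε and B = ε both bounds amount to 3ε/2 + ε/2 = 2ε.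
    rw [abs_le]
    constructor <;> linarith
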